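/- **Conventions.** The biset category (over $\mathbb Z$) has the finite groups as objects, and $\mathrm{Hom}(G,H)=B(H,G)$ is the Burnside group of finite $(H,G)$-bisets, with composition induced by $V\circ U=V\times_H U$. A *biset functor* is an additive functor from this category to abelian groups. A *Green biset functor* $A$ is a biset functor with biadditive products $A(G)\times A(H)\to A(G\times H)$, $(a,b)\mapsto a\times b$, and an identity element $\varepsilon\in A(\mathbf 1)$, such that the products commute with the biset operations and are associative and unital; $(A,A)$-bimodules, with products $a\times m$ and $m\times a$, are defined similarly. A *derivation* $d:A\to M$ with values in an $(A,A)$-bimodule $M$ is a morphism of biset functors with $d_{G\times H}(a\times b)=a\times d_H(b)+d_G(a)\times b$; it is *inner* if there is $m\in M(\mathbf 1)$ with $d_G(a)=a\times m-m\times a$ for all $G$ and $a\in A(G)$ (where $G\times\mathbf 1$ and $\mathbf 1\times G$ are identified with $G$). The first Hochschild cohomology functor $\mathcal HH^1(A,M)$ is the biset functor whose value at $X$ is the group of derivations $A\to M(-\times X)$ modulo the inner ones. The functor $A$ is *separable* if the product morphism $\mu:A\otimes A\to A$ ($\otimes$ being the tensor product of biset functors) is split surjective as a morphism of $(A,A)$-bimodules,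 equivalently if $A$ is projective as an $(A,A)$-bimodule. Let $R_{\mathbb C}$ be the Green biset functor over $\mathbb Z$ of complex characters: $R_{\mathbb C}(G)$ is the group of virtual complex characters of $G$, a biset $U$ acts by $V\mapsto \mathbb CU\otimes_{\mathbb CG}V$, and $(\chi\times\rho)(g,h)=\chi(g)\rho(h)$. Let $\widehat{\mathbb Z}^\times=\varprojlim_{n\ge 1}(\mathbb Z/n\mathbb Z)^\times$, with projections $\pi_n$; it acts on $R_{\mathbb C}(G)$ by $\big(s(\chi)\big)(g)=\chi\big(g^{\pi_n(s)}\big)$, where $n$ is any multiple of the exponent of $G$. Let $\mathcal Loc(G)$ be the group of locally constant maps $f:\widehat{\mathbb Z}^\times\to R_{\mathbb C}(G)$, i.e. maps that factor through $\pi_n$ for some $n\geq 1$. With the biset operations of $R_{\mathbb C}$ applied to the values, and with the products $(\chi\times f\times\rho)(s)=s(\chi)\times f(s)\times\rho$, $\mathcal Loc$ is an $(R_{\mathbb C},R_{\mathbb C})$-bimodule, and evaluation at $1$, $\lambda_G(f)=f(1)$, is a morphism of bimodules $\lambda:\mathcal Loc\to R_{\mathbb C}$. **Proposition.** Let $L$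 be the kernel of $\lambda:\mathcal Loc\to R_{\mathbb C}$. Then: 1. $L$ is an $(R_{\mathbb C},R_{\mathbb C})$-bimodule (a subbimodule of $\mathcal Loc$). 2. For a finite group $G$, let $d_G:R_{\mathbb C}(G)\to L(G)$ be the map defined by $d_G(\chi)(s)=s(\chi)-\chi$ for all $\chi\in R_{\mathbb C}(G)$ and $s\in\widehat{\mathbb Z}^\times$. Then the maps $d_G$ (take values in $L(G)$ and) form a non-inner derivation $R_{\mathbb C}\to L$. 3. In particular $\mathcal HH^1(R_{\mathbb C},L)(\mathbf 1)\neq 0$, so the functor $\mathcal HH^1(R_{\mathbb C},L)$ is non-zero, and the Green biset functor $R_{\mathbb C}$ is not separable: $\mu:R_{\mathbb C}\otimes R_{\mathbb C}\to R_{\mathbb C}$ does not split as a morphism of bimodules, and $R_{\mathbb C}$ is not projective as a bimodule over itself. -/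

import Mathlib

noncomputable section

namespace BisetHH

universe u v w

/-- The direct product of two finite groups, as a finite group. -/
def gprod (G H : FiniteGrp.{0}) : FiniteGrp.{0} := FiniteGrp.of (G × H)

/-- The trivial group. -/
def triv : FiniteGrp.{0} := FiniteGrp.of Unit

/-- The canonical isomorphism `(G × H) × K ≃ G × (H × K)`. -/
def gassoc (G H K : FiniteGrp.{0}) : gprod (gprod G H) K ≃* gprod G (gprod H K) :=
  MulEquiv.prodAssoc

/-- The canonical isomorphism `1 × G ≃ G`. -/
def gleft (G : FiniteGrp.{0}) : gprod triv G ≃* G where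
  toFun x := x.2
  invFun x := ((), x)
  left_inv _ := rfl
  right_inv _ := rfl
  map_mul' _ _ := rfl

/-- The canonical isomorphism `G × 1 ≃ G`. -/
def gright (G : FiniteGrp.{0}) : gprod G triv ≃* G where
  toFun x := x.1
  invFun x := (x, ())
  left_inv _ := rfl
  right_inv _ := rfl
  map_mul' _ _ := rfl

/-- The canonical isomorphism `(G × H) × K ≃ (G × K) × H` swapping the last two factors. -/
def gswap (G H K : FiniteGrp.{0}) : gprod (gprod G H) K ≃* gprod (gprod G K) H where
  toFun x := ((x.1.1, x.2), x.1.2)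
  invFun x := ((x.1.1, x.2), x.1.2)
  left_inv _ := rfl
  right_inv _ := rfl
  map_mul' _ _ := rfl

/-- The product of two group isomorphisms. -/
def gcongr {G G' H H' : FiniteGrp.{0}} (e : G ≃* G') (k : H ≃* H') :
    gprod G H ≃* gprod G' H' := MulEquiv.prodCongr e k

/-! ### Bisets -/

/-- A finite `(H, G)`-biset: a finite set with commuting left `H`-action and right `G`-action. -/
structure Biset (H G : FiniteGrp.{0}) where
  carrier : Type
  [finite : Finite carrier]
  l : H → carrier → carrier
  r : carrier → G → carrier
  one_l : ∀ x, l 1 x = x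
  mul_l : ∀ h h' x, l (h * h') x = l h (l h' x)
  r_one : ∀ x, r x 1 = x
  r_mul : ∀ x g g', r x (g * g') = r (r x g) g'
  l_r : ∀ h x g, l h (r x g) = r (l h x) g

attribute [instance] Biset.finite

namespace Biset

variable {H G K H' G' K' T : FiniteGrp.{0}}

/-- Isomorphism of bisets. -/
def Iso (U V : Biset H G) : Prop :=
  ∃ e : U.carrier ≃ V.carrier,
    (∀ h x, e (U.l h x) = V.l h (e x)) ∧ ∀ x g, e (U.r x g) = V.r (e x) g

/-- Disjoint union of bisets. -/
def sum (U V : Biset H G) : Biset H G where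
  carrier := U.carrier ⊕ V.carrier
  l h := Sum.map (U.l h) (V.l h)
  r x g := Sum.map (fun y => U.r y g) (fun y => V.r y g) x
  one_l := by rintro (x | x) <;> simp [U.one_l, V.one_l]
  mul_l := by rintro h h' (x | x) <;> simp [U.mul_l, V.mul_l]
  r_one := by rintro (x | x) <;> simp [U.r_one, V.r_one]
  r_mul := by rintro (x | x) g g' <;> simp [U.r_mul, V.r_mul]
  l_r := by rintro h (x | x) g <;> simp [U.l_r, V.l_r]

/-- The external product of an `(H, G)`-biset and an `(H', G')`-biset. -/
def prod (U : Biset H G) (V : Biset H' G') : Biset (gprod H H') (gprod G G') where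
  carrier := U.carrier × V.carrier
  l h x := (U.l h.1 x.1, V.l h.2 x.2)
  r x g := (U.r x.1 g.1, V.r x.2 g.2)
  one_l x := Prod.ext (U.one_l x.1) (V.one_l x.2)
  mul_l h h' x := Prod.ext (U.mul_l h.1 h'.1 x.1) (V.mul_l h.2 h'.2 x.2)
  r_one x := Prod.ext (U.r_one x.1) (V.r_one x.2)
  r_mul x g g' := Prod.ext (U.r_mul x.1 g.1 g'.1) (V.r_mul x.2 g.2 g'.2)
  l_r h x g := Prod.ext (U.l_r h.1 x.1 g.1) (V.l_r h.2 x.2 g.2)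

/-- The `(H, G)`-biset attached to a group isomorphism `e : G ≃* H`: the set `H`, with left
multiplication by `H` and right multiplication by the image of `G`. -/
def ofIso (e : G ≃* H) : Biset H G where
  carrier := H
  l h x := h * x
  r x g := x * e g
  one_l x := one_mul x
  mul_l h h' x := mul_assoc h h' x
  r_one x := by simp
  r_mul x g g' := by simp [mul_assoc]
  l_r h x g := (mul_assoc h x (e g)).symm

/-- The relation `(v h, y) ~ (v, h y)` on `V × U`. -/
def compSetoid (V : Biset K H) (U : Biset H G) : Setoid (V.carrier × U.carrier) where
  r p q := ∃ h : H, V.r q.1 h = p.1 ∧ U.l h p.2 = q.2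
  iseqv :=
    { refl := fun p => ⟨1, V.r_one _, U.one_l _⟩
      symm := by
        rintro p q ⟨h, h1, h2⟩
        refine ⟨h⁻¹, ?_, ?_⟩
        · rw [← h1, ← V.r_mul, mul_inv_cancel, V.r_one]
        · rw [← h2, ← U.mul_l, inv_mul_cancel, U.one_l]
      trans := by
        rintro p q s ⟨h, h1, h2⟩ ⟨k, k1, k2⟩
        refine ⟨k * h, ?_, ?_⟩
        · rw [V.r_mul, k1, h1]
        · rw [U.mul_l, h2, k2] }

/-- The underlying set `V ×_H U` of the composition of two bisets. -/
def CompCarrier (V : Biset K H) (U : Biset H G) : Type := Quotient (compSetoid V U)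

instance (V : Biset K H) (U : Biset H G) : Finite (CompCarrier V U) :=
  inferInstanceAs (Finite (Quotient _))

/-- The class of `(v, y)` in `V ×_H U`. -/
def cmk {V : Biset K H} {U : Biset H G} (v : V.carrier) (y : U.carrier) : CompCarrier V U :=
  Quotient.mk (compSetoid V U) (v, y)

theorem cmk_eq {V : Biset K H} {U : Biset H G} {v v' : V.carrier} {y y' : U.carrier} :
    (cmk v y : CompCarrier V U) = cmk v' y' ↔ ∃ h, V.r v' h = v ∧ U.l h y = y' :=
  Quotient.eq (r := compSetoid V U)

theorem cmk_bal {V : Biset K H} {U : Biset H G} (v : V.carrier) (h : H) (y : U.carrier) :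
    (cmk (V.r v h) y : CompCarrier V U) = cmk v (U.l h y) :=
  cmk_eq.2 ⟨h, rfl, rfl⟩

/-- Functions out of `V ×_H U`. -/
def clift {V : Biset K H} {U : Biset H G} {X : Type*} (p : V.carrier → U.carrier → X)
    (hp : ∀ v h y, p (V.r v h) y = p v (U.l h y)) : CompCarrier V U → X :=
  Quotient.lift (fun x => p x.1 x.2) (by
    rintro ⟨v, y⟩ ⟨v', y'⟩ ⟨h, h1, h2⟩
    dsimp only at h1 h2 ⊢
    rw [← h1, hp, h2])

@[simp] theorem clift_cmk {V : Biset K H} {U : Biset H G} {X : Type*}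
    (p : V.carrier → U.carrier → X) (hp) (v : V.carrier) (y : U.carrier) :
    clift p hp (cmk v y) = p v y := rfl

theorem cind {V : Biset K H} {U : Biset H G} {P : CompCarrier V U → Prop}
    (h : ∀ v y, P (cmk v y)) (x : CompCarrier V U) : P x :=
  Quotient.ind (fun p => h p.1 p.2) x

/-- The composition `V ×_H U` of a `(K, H)`-biset and an `(H, G)`-biset. -/
def comp (V : Biset K H) (U : Biset H G) : Biset K G where
  carrier := CompCarrier V U
  l k := clift (fun v y => cmk (V.l k v) y) (fun v h y => by rw [V.l_r, cmk_bal])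
  r x g := clift (fun v y => cmk v (U.r y g)) (fun v h y => by rw [cmk_bal, U.l_r]) x
  one_l := cind fun v y => by simp [V.one_l]
  mul_l k k' := cind fun v y => by simp [V.mul_l]
  r_one := cind fun v y => by simp [U.r_one]
  r_mul x g g' := cind (P := fun x => clift _ _ x = clift _ _ (clift _ _ x))
    (fun v y => by simp [U.r_mul]) x
  l_r k x g := cind (P := fun x => clift _ _ (clift _ _ x) = clift _ _ (clift _ _ x))
    (fun v y => by simp) x

theorem Iso.symm {U V : Biset H G} (h : Iso U V) : Iso V U := by
  obtain ⟨e, h1, h2⟩ := h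
  refine ⟨e.symm, fun h x => ?_, fun x g => ?_⟩
  · rw [Equiv.symm_apply_eq, h1, Equiv.apply_symm_apply]
  · rw [Equiv.symm_apply_eq, h2, Equiv.apply_symm_apply]

theorem Iso.trans {U V W : Biset H G} (h : Iso U V) (h' : Iso V W) : Iso U W := by
  obtain ⟨e, h1, h2⟩ := h
  obtain ⟨f, k1, k2⟩ := h'
  exact ⟨e.trans f, fun h x => by simp [h1, k1], fun x g => by simp [h2, k2]⟩

/-- A criterion for recognising a composition of bisets. -/
theorem comp_iso (V : Biset K H) (U : Biset H G) (W : Biset K G)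
    (p : V.carrier → U.carrier → W.carrier)
    (hl : ∀ k v y, p (V.l k v) y = W.l k (p v y))
    (hr : ∀ v y g, p v (U.r y g) = W.r (p v y) g)
    (hs : ∀ z, ∃ v y, p v y = z)
    (hb : ∀ v h y, p (V.r v h) y = p v (U.l h y))
    (hi : ∀ v y v' y', p v y = p v' y' → ∃ h, V.r v' h = v ∧ U.l h y = y') :
    Iso (comp V U) W := by
  refine ⟨Equiv.ofBijective (clift p hb) ⟨?_, ?_⟩, ?_, ?_⟩
  · refine cind fun v y => cind fun v' y' h => cmk_eq.2 (hi _ _ _ _ h)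
  · intro z
    obtain ⟨v, y, h⟩ := hs z
    exact ⟨cmk v y, h⟩
  · exact fun k => cind fun v y => hl k v y
  · exact fun x g => cind (P := fun x => clift p hb ((comp V U).r x g) = W.r (clift p hb x) g)
      (fun v y => hr v y g) x

theorem comp_assoc (W : Biset T K) (V : Biset K H) (U : Biset H G) :
    Iso (comp (comp W V) U) (comp W (comp V U)) := by
  refine comp_iso _ _ _
    (fun (x : CompCarrier W V) y => clift (V := W) (U := V)
      (fun w v => (cmk w (cmk v y : CompCarrier V U) : CompCarrier W (comp V U)))
      (fun w k v => cmk_bal (V := W) (U := comp V U) w k (cmk v y)) x) ?_ ?_ ?_ ?_ ?_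
  · exact fun k => cind fun w v y => rfl
  · exact cind fun w v y g => rfl
  · exact cind fun w => cind fun v y => ⟨cmk w v, y, rfl⟩
  · refine cind fun w v h y => ?_
    change (cmk w (cmk (V.r v h) y) : CompCarrier W (comp V U)) = cmk w (cmk v (U.l h y))
    rw [cmk_bal]
  · refine cind fun w v y => cind fun w' v' y' h => ?_
    obtain ⟨k, h1, h2⟩ := (cmk_eq (V := W) (U := comp V U)).1 h
    obtain ⟨h, h3, h4⟩ := (cmk_eq (V := V) (U := U)).1 h2
    refine ⟨h, ?_, h4⟩
    change (cmk w' (V.r v' h) : CompCarrier W V) = cmk w v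
    rw [h3, ← cmk_bal, h1]

theorem comp_sum_left (V V' : Biset K H) (U : Biset H G) :
    Iso (comp (V.sum V') U) ((comp V U).sum (comp V' U)) := by
  refine comp_iso _ _ _ (fun x y => Sum.map (fun v => cmk v y) (fun v => cmk v y) x)
    ?_ ?_ ?_ ?_ ?_
  · rintro k (v | v) y <;> rfl
  · rintro (v | v) y g <;> rfl
  · rintro (x | x)
    · exact cind (V := V) (U := U) (P := fun x => ∃ (v : V.carrier ⊕ V'.carrier) (y : U.carrier),
          Sum.map (fun v => (cmk v y : CompCarrier V U)) (fun v => (cmk v y : CompCarrier V' U)) v =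
            Sum.inl x)
        (fun v y => ⟨Sum.inl v, y, rfl⟩) x
    · exact cind (V := V') (U := U) (P := fun x => ∃ (v : V.carrier ⊕ V'.carrier) (y : U.carrier),
          Sum.map (fun v => (cmk v y : CompCarrier V U)) (fun v => (cmk v y : CompCarrier V' U)) v =
            Sum.inr x)
        (fun v y => ⟨Sum.inr v, y, rfl⟩) x
  · rintro (v | v) h y
    · exact congrArg Sum.inl (cmk_bal v h y)
    · exact congrArg Sum.inr (cmk_bal v h y)
  · rintro (v | v) y (v' | v') y' h
    · obtain ⟨h, h1, h2⟩ := cmk_eq.1 (Sum.inl.inj h)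
      exact ⟨h, congrArg Sum.inl h1, h2⟩
    · cases h
    · cases h
    · obtain ⟨h, h1, h2⟩ := cmk_eq.1 (Sum.inr.inj h)
      exact ⟨h, congrArg Sum.inr h1, h2⟩

theorem comp_sum_right (V : Biset K H) (U U' : Biset H G) :
    Iso (comp V (U.sum U')) ((comp V U).sum (comp V U')) := by
  refine comp_iso _ _ _ (fun v x => Sum.map (fun y => cmk v y) (fun y => cmk v y) x)
    ?_ ?_ ?_ ?_ ?_
  · rintro k v (y | y) <;> rfl
  · rintro v (y | y) g <;> rfl
  · rintro (x | x)
    · exact cind (V := V) (U := U) (P := fun x => ∃ (v : V.carrier) (y : U.carrier ⊕ U'.carrier),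
          Sum.map (fun y => (cmk v y : CompCarrier V U)) (fun y => (cmk v y : CompCarrier V U')) y =
            Sum.inl x)
        (fun v y => ⟨v, Sum.inl y, rfl⟩) x
    · exact cind (V := V) (U := U') (P := fun x => ∃ (v : V.carrier) (y : U.carrier ⊕ U'.carrier),
          Sum.map (fun y => (cmk v y : CompCarrier V U)) (fun y => (cmk v y : CompCarrier V U')) y =
            Sum.inr x)
        (fun v y => ⟨v, Sum.inr y, rfl⟩) x
  · rintro v h (y | y)
    · exact congrArg Sum.inl (cmk_bal v h y)
    · exact congrArg Sum.inr (cmk_bal v h y)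
  · rintro v (y | y) v' (y' | y') h
    · obtain ⟨h, h1, h2⟩ := cmk_eq.1 (Sum.inl.inj h)
      exact ⟨h, h1, congrArg Sum.inl h2⟩
    · cases h
    · cases h
    · obtain ⟨h, h1, h2⟩ := cmk_eq.1 (Sum.inr.inj h)
      exact ⟨h, h1, congrArg Sum.inr h2⟩

theorem comp_congr {V V' : Biset K H} {U U' : Biset H G} (hV : Iso V V') (hU : Iso U U') :
    Iso (comp V U) (comp V' U') := by
  obtain ⟨e, e1, e2⟩ := hV
  obtain ⟨f, f1, f2⟩ := hU
  refine comp_iso _ _ _ (fun v y => cmk (e v) (f y)) ?_ ?_ ?_ ?_ ?_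
  · intro k v y
    rw [e1]; rfl
  · intro v y g
    rw [f2]; rfl
  · exact cind fun v y => ⟨e.symm v, f.symm y, by
      rw [e.apply_symm_apply, f.apply_symm_apply]⟩
  · intro v h y
    rw [e2, f1, cmk_bal]
  · intro v y v' y' h
    obtain ⟨h, h1, h2⟩ := cmk_eq.1 h
    exact ⟨h, e.injective (by rw [e2, h1]), f.injective (by rw [f1, h2])⟩

theorem id_comp (U : Biset H G) : Iso (comp (ofIso (MulEquiv.refl H)) U) U := by
  refine comp_iso _ _ _ (fun (h : H) y => U.l h y) ?_ ?_ ?_ ?_ ?_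
  · exact fun k v y => U.mul_l k v y
  · exact fun v y g => U.l_r v y g
  · exact fun z => ⟨(1 : H), z, U.one_l z⟩
  · exact fun v h y => U.mul_l v h y
  · intro (v : H) y (v' : H) y' h
    refine ⟨v'⁻¹ * v, ?_, ?_⟩
    · exact mul_inv_cancel_left v' v
    · rw [U.mul_l, h, ← U.mul_l, inv_mul_cancel, U.one_l]

/-- Naturality of the bisets attached to isomorphisms of groups. -/
theorem ofIso_comp (U : Biset H G) (U' : Biset H' G') (e : G ≃* G') (k : H ≃* H')
    (t : U.carrier ≃ U'.carrier) (tl : ∀ h x, t (U.l h x) = U'.l (k h) (t x))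
    (tr : ∀ x g, t (U.r x g) = U'.r (t x) (e g)) :
    Iso (comp (ofIso k) U) (comp U' (ofIso e)) := by
  let W : Biset H' G :=
    { carrier := U'.carrier
      l := U'.l
      r := fun x g => U'.r x (e g)
      one_l := U'.one_l
      mul_l := U'.mul_l
      r_one := fun x => by rw [map_one, U'.r_one]
      r_mul := fun x g g' => by rw [map_mul, U'.r_mul]
      l_r := fun h x g => U'.l_r h x (e g) }
  have h1 : Iso (comp (ofIso k) U) W := by
    refine comp_iso _ _ _ (fun (h : H') y => U'.l h (t y)) ?_ ?_ ?_ ?_ ?_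
    · exact fun h v y => U'.mul_l h v (t y)
    · intro v y g
      rw [tr]
      exact U'.l_r v (t y) (e g)
    · exact fun z => ⟨(1 : H'), t.symm z, by rw [U'.one_l, t.apply_symm_apply]⟩
    · intro v h y
      rw [tl]
      exact U'.mul_l v (k h) (t y)
    · intro (v : H') y (v' : H') y' h
      refine ⟨k.symm (v'⁻¹ * v), ?_, ?_⟩
      · change v' * k (k.symm (v'⁻¹ * v)) = v
        simp
      · apply t.injective
        rw [tl, MulEquiv.apply_symm_apply, U'.mul_l, h, ← U'.mul_l, inv_mul_cancel, U'.one_l]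
  have h2 : Iso (comp U' (ofIso e)) W := by
    refine comp_iso _ _ _ (fun v (g : G') => U'.r v g) ?_ ?_ ?_ ?_ ?_
    · exact fun h v y => (U'.l_r h v y).symm
    · exact fun v y g => U'.r_mul v y (e g)
    · exact fun z => ⟨z, (1 : G'), U'.r_one z⟩
    · exact fun v h y => (U'.r_mul v h y).symm
    · intro v (y : G') v' (y' : G') h
      refine ⟨y' * y⁻¹, ?_, ?_⟩
      · rw [U'.r_mul, ← h, ← U'.r_mul, mul_inv_cancel, U'.r_one]
      · exact inv_mul_cancel_right y' y
  exact h1.trans h2.symm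

theorem comp_id (U : Biset H G) : Iso (comp U (ofIso (MulEquiv.refl G))) U :=
  (ofIso_comp U U (MulEquiv.refl G) (MulEquiv.refl H) (Equiv.refl _) (fun _ _ => rfl)
    (fun _ _ => rfl)).symm.trans (id_comp U)

theorem ofIso_trans (e : G ≃* H) (k : H ≃* K) :
    Iso (comp (ofIso k) (ofIso e)) (ofIso (e.trans k)) :=
  (ofIso_comp (ofIso e) (ofIso (e.trans k)) (MulEquiv.refl G) k k.toEquiv (fun _ _ => map_mul k _ _)
    (fun _ _ => map_mul k _ _)).trans (comp_id _)

theorem prod_ofIso (e : G ≃* H) (e' : G' ≃* H') :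
    Iso (prod (ofIso e) (ofIso e')) (ofIso (gcongr e e')) :=
  ⟨Equiv.refl _, fun _ _ => rfl, fun _ _ => rfl⟩

theorem prod_congr {U V : Biset H G} {U' V' : Biset H' G'} (h : Iso U V) (h' : Iso U' V') :
    Iso (prod U U') (prod V V') := by
  obtain ⟨e, e1, e2⟩ := h
  obtain ⟨f, f1, f2⟩ := h'
  exact ⟨e.prodCongr f, fun h x => Prod.ext (e1 _ _) (f1 _ _),
    fun x g => Prod.ext (e2 _ _) (f2 _ _)⟩

theorem prod_sum_left (U V : Biset H G) (W : Biset H' G') :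
    Iso (prod (U.sum V) W) ((prod U W).sum (prod V W)) :=
  ⟨Equiv.sumProdDistrib _ _ _, by rintro h ⟨x | x, y⟩ <;> rfl, by rintro ⟨x | x, y⟩ g <;> rfl⟩

theorem prod_sum_right (W : Biset H' G') (U V : Biset H G) :
    Iso (prod W (U.sum V)) ((prod W U).sum (prod W V)) :=
  ⟨Equiv.prodSumDistrib _ _ _, by rintro h ⟨y, x | x⟩ <;> rfl, by rintro ⟨y, x | x⟩ g <;> rfl⟩

theorem prod_comp (V : Biset K H) (U : Biset H G) (V' : Biset K' H') (U' : Biset H' G') :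
    Iso (comp (prod V V') (prod U U')) (prod (comp V U) (comp V' U')) := by
  refine comp_iso _ _ _ (fun v y => (cmk v.1 y.1, cmk v.2 y.2)) ?_ ?_ ?_ ?_ ?_
  · exact fun k v y => rfl
  · exact fun v y g => rfl
  · rintro ⟨z, z'⟩
    revert z'
    refine cind (V := V) (U := U) (P := fun z => ∀ z' : CompCarrier V' U',
      ∃ (v : V.carrier × V'.carrier) (y : U.carrier × U'.carrier),
        ((cmk v.1 y.1, cmk v.2 y.2) : CompCarrier V U × CompCarrier V' U') = (z, z')) (fun v y => ?_) z
    refine cind (V := V') (U := U') fun v' y' => ?_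
    exact ⟨(v, v'), (y, y'), rfl⟩
  · exact fun v h y => Prod.ext (cmk_bal v.1 h.1 y.1) (cmk_bal v.2 h.2 y.2)
  · intro v y v' y' h
    obtain ⟨h1, a, b⟩ := cmk_eq.1 (congrArg Prod.fst h)
    obtain ⟨h2, c, d⟩ := cmk_eq.1 (congrArg Prod.snd h)
    exact ⟨(h1, h2), Prod.ext a c, Prod.ext b d⟩

end Biset

/-! ### Burnside groups and the biset category -/

/-- The defining relations of the Burnside group. -/
def burnRel (H G : FiniteGrp.{0}) : AddSubgroup (FreeAbelianGroup (Biset H G)) :=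
  AddSubgroup.closure {x | ∃ W U V : Biset H G, W.Iso (U.sum V) ∧
    x = FreeAbelianGroup.of W - FreeAbelianGroup.of U - FreeAbelianGroup.of V}

/-- The Burnside group `B(H, G)`: the Grothendieck group of finite `(H, G)`-bisets, generated by
the finite bisets, with a relation `[W] = [U] + [V]` whenever `W` is isomorphic to the disjoint
union of `U` and `V`. It is the group of morphisms from `G` to `H` in the biset category. -/
def Burn (H G : FiniteGrp.{0}) : Type 1 := FreeAbelianGroup (Biset H G) ⧸ burnRel H G

instance (H G : FiniteGrp.{0}) : AddCommGroup (Burn H G) :=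
  inferInstanceAs (AddCommGroup (FreeAbelianGroup (Biset H G) ⧸ burnRel H G))

namespace Burn

variable {H G K H' G' K' T : FiniteGrp.{0}}

/-- The class of a biset. -/
def of (U : Biset H G) : Burn H G := QuotientAddGroup.mk (FreeAbelianGroup.of U)

/-- The universal property of the Burnside group. -/
def lift {X : Type*} [AddCommGroup X] (f : Biset H G → X)
    (hf : ∀ W U V, Biset.Iso W (U.sum V) → f W = f U + f V) : Burn H G →+ X :=
  QuotientAddGroup.lift (burnRel H G) (FreeAbelianGroup.lift f) (by
    rw [burnRel, AddSubgroup.closure_le]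
    rintro x ⟨W, U, V, h, rfl⟩
    simp [hf W U V h])

@[simp] theorem lift_of {X : Type*} [AddCommGroup X] (f : Biset H G → X) (hf) (U : Biset H G) :
    lift f hf (of U) = f U := by
  change FreeAbelianGroup.lift f (FreeAbelianGroup.of U) = f U
  simp

theorem ind {P : Burn H G → Prop} (h0 : P 0) (ho : ∀ U, P (of U)) (hn : ∀ x, P x → P (-x))
    (ha : ∀ x y, P x → P y → P (x + y)) (x : Burn H G) : P x := by
  induction x using QuotientAddGroup.induction_on with
  | H z =>
    induction z using FreeAbelianGroup.induction_on with
    | zero => exact h0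
    | of U => exact ho U
    | neg U h => exact hn _ h
    | add x y hx hy => exact ha _ _ hx hy

theorem hom_ext {X : Type*} [AddCommGroup X] {f g : Burn H G →+ X}
    (h : ∀ U, f (of U) = g (of U)) : f = g := by
  ext x
  induction x using ind with
  | h0 => simp
  | ho U => exact h U
  | hn x hx => simp [hx]
  | ha x y hx hy => simp [hx, hy]

theorem of_sum {W U V : Biset H G} (h : W.Iso (U.sum V)) : of W = of U + of V := by
  have : FreeAbelianGroup.of W - FreeAbelianGroup.of U - FreeAbelianGroup.of V ∈ burnRel H G :=
    AddSubgroup.subset_closure ⟨W, U, V, h, rfl⟩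
  have h2 : ((FreeAbelianGroup.of W - FreeAbelianGroup.of U - FreeAbelianGroup.of V :
    FreeAbelianGroup (Biset H G)) : FreeAbelianGroup (Biset H G) ⧸ burnRel H G) = 0 :=
    (QuotientAddGroup.eq_zero_iff _).2 this
  have h3 : of W - of U - of V = 0 := h2
  rw [sub_sub, sub_eq_zero] at h3
  exact h3

theorem of_iso {U V : Biset H G} (h : U.Iso V) : of U = of V := by
  let E : Biset H G := ⟨Empty, fun _ x => x, fun x _ => x, fun _ => rfl, fun _ _ _ => rfl,
    fun _ => rfl, fun _ _ _ => rfl, fun _ _ _ => rfl⟩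
  have hs : ∀ W : Biset H G, W.Iso (W.sum E) := fun W =>
    ⟨(Equiv.sumEmpty W.carrier Empty).symm, fun _ _ => rfl, fun _ _ => rfl⟩
  rw [of_sum (h.trans (hs V)), ← of_sum (hs V)]

/-- Composition in the biset category: the biadditive extension of `(V, U) ↦ V ×_H U`. -/
def comp : Burn K H →+ Burn H G →+ Burn K G :=
  lift (fun V => lift (fun U => of (V.comp U)) (fun W U U' h => of_sum
      ((Biset.comp_congr ⟨Equiv.refl _, fun _ _ => rfl, fun _ _ => rfl⟩ h).trans
        (Biset.comp_sum_right V U U'))))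
    (fun W V V' h => hom_ext fun U => by
      simp only [lift_of, AddMonoidHom.add_apply]
      exact of_sum ((Biset.comp_congr h ⟨Equiv.refl _, fun _ _ => rfl, fun _ _ => rfl⟩).trans
        (Biset.comp_sum_left V V' U)))

/-- The product of morphisms in the biset category: the biadditive extension of the external
product of bisets. -/
def prod : Burn H G →+ Burn H' G' →+ Burn (gprod H H') (gprod G G') :=
  lift (fun V => lift (fun U => of (V.prod U)) (fun W U U' h => of_sum
      ((Biset.prod_congr ⟨Equiv.refl _, fun _ _ => rfl, fun _ _ => rfl⟩ h).trans
        (Biset.prod_sum_right V U U'))))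
    (fun W V V' h => hom_ext fun U => by
      simp only [lift_of, AddMonoidHom.add_apply]
      exact of_sum ((Biset.prod_congr h ⟨Equiv.refl _, fun _ _ => rfl, fun _ _ => rfl⟩).trans
        (Biset.prod_sum_left V V' U)))

/-- The morphism from `G` to `H` attached to a group isomorphism. -/
def iso (e : G ≃* H) : Burn H G := of (Biset.ofIso e)

/-- The identity morphism of `G`, i.e. the class of the `(G, G)`-biset `G`. -/
def id (G : FiniteGrp.{0}) : Burn G G := iso (MulEquiv.refl G)

theorem comp_of (V : Biset K H) (U : Biset H G) : comp (of V) (of U) = of (V.comp U) := by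
  simp [comp]

theorem prod_of (V : Biset H G) (U : Biset H' G') : prod (of V) (of U) = of (V.prod U) := by
  simp [prod]

theorem id_comp (x : Burn H G) : comp (id H) x = x :=
  DFunLike.congr_fun (f := comp (id H)) (g := AddMonoidHom.id _)
    (hom_ext fun U => by simpa [id, iso, comp_of] using of_iso (Biset.id_comp U)) x

theorem comp_id (x : Burn H G) : comp x (id G) = x :=
  DFunLike.congr_fun (f := (comp (K := H)).flip (id G)) (g := AddMonoidHom.id _)
    (hom_ext fun U => by simpa [id, iso, comp_of] using of_iso (Biset.comp_id U)) x

theorem comp_assoc (x : Burn T K) (y : Burn K H) (z : Burn H G) :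
    comp (comp x y) z = comp x (comp y z) := by
  induction x using ind with
  | h0 => simp
  | hn x hx => simp [hx]
  | ha x y hx hy => simp [hx, hy]
  | ho W =>
  induction y using ind with
  | h0 => simp
  | hn x hx => simp [hx]
  | ha x y hx hy => simp [hx, hy]
  | ho V =>
  induction z using ind with
  | h0 => simp
  | hn x hx => simp [hx]
  | ha x y hx hy => simp [hx, hy]
  | ho U => simpa [comp_of, prod_of] using of_iso (Biset.comp_assoc W V U)

theorem prod_comp (x : Burn K H) (y : Burn H G) (x' : Burn K' H') (y' : Burn H' G') :
    comp (prod x x') (prod y y') = prod (comp x y) (comp x' y') := by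
  induction x using ind with
  | h0 => simp
  | hn x hx => simp [hx]
  | ha x y hx hy => simp [hx, hy]
  | ho W =>
  induction y using ind with
  | h0 => simp
  | hn x hx => simp [hx]
  | ha x y hx hy => simp [hx, hy]
  | ho V =>
  induction x' using ind with
  | h0 => simp
  | hn x hx => simp [hx]
  | ha x y hx hy => simp [hx, hy]
  | ho W' =>
  induction y' using ind with
  | h0 => simp
  | hn x hx => simp [hx]
  | ha x y hx hy => simp [hx, hy]
  | ho V' => simpa [comp_of, prod_of] using of_iso (Biset.prod_comp W V W' V')

theorem iso_comp_iso (e : G ≃* H) (k : H ≃* K) : comp (iso k) (iso e) = iso (e.trans k) := by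
  simpa [iso, comp_of, prod_of] using of_iso (Biset.ofIso_trans e k)

theorem prod_iso (e : G ≃* H) (e' : G' ≃* H') :
    prod (iso e) (iso e') = iso (gcongr e e') := by
  simpa [iso, comp_of, prod_of] using of_iso (Biset.prod_ofIso e e')

theorem prod_id (G H : FiniteGrp.{0}) : prod (id G) (id H) = id (gprod G H) :=
  prod_iso _ _

variable {G₁ G₂ G₃ H₁ H₂ H₃ : FiniteGrp.{0}}

theorem assoc_nat (x : Burn H₁ G₁) (y : Burn H₂ G₂) (z : Burn H₃ G₃) :
    comp (iso (gassoc _ _ _)) (prod (prod x y) z) =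
      comp (prod x (prod y z)) (iso (gassoc _ _ _)) := by
  induction x using ind with
  | h0 => simp
  | hn x hx => simp [hx]
  | ha x y hx hy => simp [hx, hy]
  | ho U =>
  induction y using ind with
  | h0 => simp
  | hn x hx => simp [hx]
  | ha x y hx hy => simp [hx, hy]
  | ho V =>
  induction z using ind with
  | h0 => simp
  | hn x hx => simp [hx]
  | ha x y hx hy => simp [hx, hy]
  | ho W =>
    simp only [iso, prod_of, comp_of]
    exact of_iso (Biset.ofIso_comp _ _ _ _ (Equiv.prodAssoc _ _ _) (fun _ _ => rfl)
      (fun _ _ => rfl))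

theorem swap_nat (x : Burn H₁ G₁) (y : Burn H₂ G₂) (z : Burn H₃ G₃) :
    comp (iso (gswap _ _ _)) (prod (prod x y) z) =
      comp (prod (prod x z) y) (iso (gswap _ _ _)) := by
  induction x using ind with
  | h0 => simp
  | hn x hx => simp [hx]
  | ha x y hx hy => simp [hx, hy]
  | ho U =>
  induction y using ind with
  | h0 => simp
  | hn x hx => simp [hx]
  | ha x y hx hy => simp [hx, hy]
  | ho V =>
  induction z using ind with
  | h0 => simp
  | hn x hx => simp [hx]
  | ha x y hx hy => simp [hx, hy]
  | ho W =>
    simp only [iso, prod_of, comp_of]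
    exact of_iso (Biset.ofIso_comp _ _ _ _ ⟨fun x => ((x.1.1, x.2), x.1.2),
      fun x => ((x.1.1, x.2), x.1.2), fun _ => rfl, fun _ => rfl⟩ (fun _ _ => rfl)
      (fun _ _ => rfl))

theorem left_nat (x : Burn H G) :
    comp (iso (gleft H)) (prod (id triv) x) = comp x (iso (gleft G)) := by
  induction x using ind with
  | h0 => simp
  | hn x hx => simp [hx]
  | ha x y hx hy => simp [hx, hy]
  | ho U =>
    simp only [iso, id, prod_of, comp_of]
    exact of_iso (Biset.ofIso_comp _ _ _ _ ⟨fun x => x.2, fun x => ((), x), fun _ => rfl,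
      fun _ => rfl⟩ (fun _ _ => rfl) (fun _ _ => rfl))

theorem right_nat (x : Burn H G) :
    comp (iso (gright H)) (prod x (id triv)) = comp x (iso (gright G)) := by
  induction x using ind with
  | h0 => simp
  | hn x hx => simp [hx]
  | ha x y hx hy => simp [hx, hy]
  | ho U =>
    simp only [iso, id, prod_of, comp_of]
    exact of_iso (Biset.ofIso_comp _ _ _ _ ⟨fun x => x.1, fun x => (x, ()), fun _ => rfl,
      fun _ => rfl⟩ (fun _ _ => rfl) (fun _ _ => rfl))

/-- Naturality of the inverse associativity isomorphism. -/
theorem assoc_symm_nat (x : Burn H₁ G₁) (y : Burn H₂ G₂) (z : Burn H₃ G₃) :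
    comp (iso (gassoc _ _ _).symm) (prod x (prod y z)) =
      comp (prod (prod x y) z) (iso (gassoc _ _ _).symm) := by
  have h := congrArg (fun t => comp (iso (gassoc H₁ H₂ H₃).symm)
    (comp t (iso (gassoc G₁ G₂ G₃).symm))) (assoc_nat x y z)
  simp only [comp_assoc, iso_comp_iso, MulEquiv.symm_trans_self] at h
  rw [← comp_assoc, iso_comp_iso, MulEquiv.self_trans_symm] at h
  change comp (id _) _ = comp _ (comp _ (id _)) at h
  rw [id_comp, comp_id] at h
  exact h.symm

end Burn

/-! ### Biset functors, Green biset functors and bimodules -/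

/-- A biset functor over `ℤ`: an additive functor from the biset category to abelian groups. -/
structure BisetFunctor where
  obj : FiniteGrp.{0} → Type u
  [grp : ∀ G, AddCommGroup (obj G)]
  map : ∀ {H G : FiniteGrp.{0}}, Burn H G →+ obj G →+ obj H
  map_id : ∀ (G : FiniteGrp.{0}) (x : obj G), map (Burn.id G) x = x
  map_comp : ∀ {K H G : FiniteGrp.{0}} (ψ : Burn K H) (φ : Burn H G) (x : obj G),
    map (Burn.comp ψ φ) x = map ψ (map φ x)

attribute [instance] BisetFunctor.grp

/-- A Green biset functor over `ℤ`: a biset functor with biadditive products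
`A(G) × A(H) → A(G × H)` and an identity element in `A(1)`, such that the products are functorial,
associative and unital. -/
structure GreenFunctor extends BisetFunctor.{u} where
  mul : ∀ {G H : FiniteGrp.{0}}, obj G →+ obj H →+ obj (gprod G H)
  one : obj triv
  mul_map : ∀ {G G' H H' : FiniteGrp.{0}} (φ : Burn G' G) (ψ : Burn H' H) (a : obj G) (b : obj H),
    map (Burn.prod φ ψ) (mul a b) = mul (map φ a) (map ψ b)
  mul_assoc : ∀ {G H K : FiniteGrp.{0}} (a : obj G) (b : obj H) (c : obj K),
    map (Burn.iso (gassoc G H K)) (mul (mul a b) c) = mul a (mul b c)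
  one_mul : ∀ {G : FiniteGrp.{0}} (a : obj G), map (Burn.iso (gleft G)) (mul one a) = a
  mul_one : ∀ {G : FiniteGrp.{0}} (a : obj G), map (Burn.iso (gright G)) (mul a one) = a

/-- An `(A, A)`-bimodule over a Green biset functor `A`. -/
structure Bimodule (A : GreenFunctor.{u}) extends BisetFunctor.{v} where
  lact : ∀ {G H : FiniteGrp.{0}}, A.obj G →+ obj H →+ obj (gprod G H)
  ract : ∀ {G H : FiniteGrp.{0}}, obj G →+ A.obj H →+ obj (gprod G H)
  lact_map : ∀ {G G' H H' : FiniteGrp.{0}} (φ : Burn G' G) (ψ : Burn H' H) (a : A.obj G)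
    (m : obj H), map (Burn.prod φ ψ) (lact a m) = lact (A.map φ a) (map ψ m)
  ract_map : ∀ {G G' H H' : FiniteGrp.{0}} (φ : Burn G' G) (ψ : Burn H' H) (m : obj G)
    (a : A.obj H), map (Burn.prod φ ψ) (ract m a) = ract (map φ m) (A.map ψ a)
  mul_lact : ∀ {G H K : FiniteGrp.{0}} (a : A.obj G) (b : A.obj H) (m : obj K),
    map (Burn.iso (gassoc G H K)) (lact (A.mul a b) m) = lact a (lact b m)
  ract_mul : ∀ {G H K : FiniteGrp.{0}} (m : obj G) (a : A.obj H) (b : A.obj K),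
    map (Burn.iso (gassoc G H K)) (ract (ract m a) b) = ract m (A.mul a b)
  lact_ract : ∀ {G H K : FiniteGrp.{0}} (a : A.obj G) (m : obj H) (b : A.obj K),
    map (Burn.iso (gassoc G H K)) (ract (lact a m) b) = lact a (ract m b)
  one_lact : ∀ {G : FiniteGrp.{0}} (m : obj G), map (Burn.iso (gleft G)) (lact A.one m) = m
  ract_one : ∀ {G : FiniteGrp.{0}} (m : obj G), map (Burn.iso (gright G)) (ract m A.one) = m

/-- A Green biset functor, as a bimodule over itself. -/
def GreenFunctor.regular (A : GreenFunctor.{u}) : Bimodule.{u, u} A where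
  toBisetFunctor := A.toBisetFunctor
  lact := A.mul
  ract := A.mul
  lact_map := A.mul_map
  ract_map := A.mul_map
  mul_lact := A.mul_assoc
  ract_mul := A.mul_assoc
  lact_ract := A.mul_assoc
  one_lact := A.one_mul
  ract_one := A.mul_one

/-- Morphisms of `(A, A)`-bimodules. -/
structure Bimodule.Hom {A : GreenFunctor.{u}} (M : Bimodule.{u, v} A) (N : Bimodule.{u, w} A) where
  app : ∀ G : FiniteGrp.{0}, M.obj G →+ N.obj G
  naturality : ∀ {H G : FiniteGrp.{0}} (φ : Burn H G) (m : M.obj G),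
    app H (M.map φ m) = N.map φ (app G m)
  map_lact : ∀ {G H : FiniteGrp.{0}} (a : A.obj G) (m : M.obj H),
    app (gprod G H) (M.lact a m) = N.lact a (app H m)
  map_ract : ∀ {G H : FiniteGrp.{0}} (m : M.obj G) (a : A.obj H),
    app (gprod G H) (M.ract m a) = N.ract (app G m) a

/-- A family of subgroups of the values of a bimodule is a subbimodule if it is stable by the
action of bisets and by the left and right actions of the Green biset functor. -/
structure Bimodule.IsSubbimodule {A : GreenFunctor.{u}} (M : Bimodule.{u, v} A)
    (S : ∀ G : FiniteGrp.{0}, AddSubgroup (M.obj G)) : Prop where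
  map_mem : ∀ {H G : FiniteGrp.{0}} (φ : Burn H G) (m : M.obj G), m ∈ S G → M.map φ m ∈ S H
  lact_mem : ∀ {G H : FiniteGrp.{0}} (a : A.obj G) (m : M.obj H), m ∈ S H →
    M.lact a m ∈ S (gprod G H)
  ract_mem : ∀ {G H : FiniteGrp.{0}} (m : M.obj G) (a : A.obj H), m ∈ S G →
    M.ract m a ∈ S (gprod G H)

/-- A subbimodule, as a bimodule. -/
def Bimodule.sub {A : GreenFunctor.{u}} (M : Bimodule.{u, v} A)
    (S : ∀ G : FiniteGrp.{0}, AddSubgroup (M.obj G)) (hS : M.IsSubbimodule S) :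
    Bimodule.{u, v} A where
  obj G := S G
  map {H G} := AddMonoidHom.mk' (fun φ => AddMonoidHom.mk'
      (fun m => ⟨M.map φ m, hS.map_mem φ m m.2⟩) (fun _ _ => Subtype.ext (by simp)))
    (fun _ _ => by ext; simp)
  map_id G x := Subtype.ext (M.map_id G x)
  map_comp ψ φ x := Subtype.ext (M.map_comp ψ φ x)
  lact {G H} := AddMonoidHom.mk' (fun a => AddMonoidHom.mk'
      (fun m : S H => ⟨M.lact a (m : M.obj H), hS.lact_mem a m.1 m.2⟩) (fun _ _ => Subtype.ext (by simp)))
    (fun _ _ => by ext; simp)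
  ract {G H} := AddMonoidHom.mk' (fun m : S G => AddMonoidHom.mk'
      (fun a => ⟨M.ract (m : M.obj G) a, hS.ract_mem m.1 a m.2⟩) (fun _ _ => Subtype.ext (by simp)))
    (fun _ _ => by ext; simp)
  lact_map φ ψ a m := Subtype.ext (M.lact_map φ ψ a m)
  ract_map φ ψ m a := Subtype.ext (M.ract_map φ ψ m a)
  mul_lact a b m := Subtype.ext (M.mul_lact a b m.1)
  ract_mul m a b := Subtype.ext (M.ract_mul m.1 a b)
  lact_ract a m b := Subtype.ext (M.lact_ract a m.1 b)
  one_lact m := Subtype.ext (M.one_lact m.1)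
  ract_one m := Subtype.ext (M.ract_one m.1)

/-! ### Derivations and the first Hochschild cohomology functor -/

/-- The biset-functor morphisms `d : A → M` with `d (a × b) = a × d b + d a × b`, as a group. -/
def Der {A : GreenFunctor.{u}} (M : Bimodule.{u, v} A) :
    AddSubgroup (∀ G : FiniteGrp.{0}, A.obj G →+ M.obj G) where
  carrier := {d | (∀ (H G : FiniteGrp.{0}) (φ : Burn H G) (a : A.obj G),
      d H (A.map φ a) = M.map φ (d G a)) ∧
    ∀ (G H : FiniteGrp.{0}) (a : A.obj G) (b : A.obj H),
      d (gprod G H) (A.mul a b) = M.lact a (d H b) + M.ract (d G a) b}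
  zero_mem' := ⟨fun _ _ _ _ => by simp, fun _ _ _ _ => by simp⟩
  add_mem' := fun {d d'} h h' => ⟨fun H G φ a => by simp [h.1, h'.1],
    fun G H a b => by simp only [Pi.add_apply, AddMonoidHom.add_apply, h.2, h'.2, map_add]; abel⟩
  neg_mem' := fun {d} h => ⟨fun H G φ a => by simp [h.1],
    fun G H a b => by simp only [Pi.neg_apply, AddMonoidHom.neg_apply, h.2, map_neg]; abel⟩

/-- The inner derivation `a ↦ a × m - m × a` attached to `m ∈ M(1)`, where `M(G × 1)` and
`M(1 × G)` are identified with `M(G)`. -/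
def innerDer {A : GreenFunctor.{u}} (M : Bimodule.{u, v} A) :
    M.obj triv →+ ∀ G : FiniteGrp.{0}, A.obj G →+ M.obj G :=
  AddMonoidHom.mk' (fun m G => AddMonoidHom.mk'
      (fun a => M.map (Burn.iso (gright G)) (M.lact a m) - M.map (Burn.iso (gleft G)) (M.ract m a))
      (fun a b => by simp only [map_add, AddMonoidHom.add_apply]; abel))
    (fun m m' => by
      ext G a
      simp only [map_add, AddMonoidHom.add_apply, AddMonoidHom.mk'_apply, Pi.add_apply]; abel)

section Shift


variable {A : GreenFunctor.{u}} (M : Bimodule.{u, v} A)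
variable {G G' H H' K X Y Z : FiniteGrp.{0}}

theorem Bimodule.iso_iso (e : G ≃* H) (k : H ≃* K) (m : M.obj G) :
    M.map (Burn.iso k) (M.map (Burn.iso e) m) = M.map (Burn.iso (e.trans k)) m := by
  rw [← M.map_comp, Burn.iso_comp_iso]

theorem Bimodule.lact_iso (a : A.obj G) (e : H ≃* H') (m : M.obj H) :
    M.lact a (M.map (Burn.iso e) m) =
      M.map (Burn.iso (gcongr (MulEquiv.refl G) e)) (M.lact a m) := by
  rw [← Burn.prod_iso, M.lact_map]
  congr 1
  exact congrArg _ (A.map_id G a).symm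

theorem Bimodule.ract_iso (a : A.obj G) (e : H ≃* H') (m : M.obj H) :
    M.ract (M.map (Burn.iso e) m) a =
      M.map (Burn.iso (gcongr e (MulEquiv.refl G))) (M.ract m a) := by
  rw [← Burn.prod_iso, M.ract_map]
  congr 1
  exact (A.map_id G a).symm

theorem innerDer_mem (m : M.obj triv) : innerDer M m ∈ Der M := by
  refine ⟨fun H G φ a => ?_, fun G H a b => ?_⟩
  · change M.map _ (M.lact _ m) - M.map _ (M.ract m _) = M.map φ (M.map _ _ - M.map _ _)
    rw [map_sub]
    congr 1
    · nth_rewrite 1 [← M.map_id _ m]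
      rw [← M.lact_map, ← M.map_comp, ← M.map_comp, Burn.right_nat]
    · nth_rewrite 1 [← M.map_id _ m]
      rw [← M.ract_map, ← M.map_comp, ← M.map_comp, Burn.left_nat]
  · change M.map _ (M.lact _ m) - M.map _ (M.ract m _) =
      M.lact a (M.map _ _ - M.map _ _) + M.ract (M.map _ _ - M.map _ _) b
    rw [map_sub, map_sub, AddMonoidHom.sub_apply, M.lact_iso, M.lact_iso, M.ract_iso, M.ract_iso,
      ← M.mul_lact, ← M.lact_ract, ← M.ract_mul]
    simp only [M.iso_iso]
    have h1 : (gassoc G H triv).trans (gcongr (MulEquiv.refl G) (gright H)) =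
      gright (gprod G H) := rfl
    have h2 : (gassoc triv G H).trans (gleft (gprod G H)) =
      gcongr (gleft G) (MulEquiv.refl H) := rfl
    have h3 : (gassoc G triv H).trans (gcongr (MulEquiv.refl G) (gleft H)) =
      gcongr (gright G) (MulEquiv.refl H) := rfl
    rw [h1, h2, h3]
    abel

/-- The bimodule `M(- × X)` obtained by shifting a bimodule `M` by the finite group `X`. -/
def Bimodule.shift (X : FiniteGrp.{0}) : Bimodule.{u, v} A where
  obj G := M.obj (gprod G X)
  map := M.map.comp (Burn.prod.flip (Burn.id X))
  map_id G x := by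
    change M.map (Burn.prod (Burn.id G) (Burn.id X)) x = x
    rw [Burn.prod_id, M.map_id]
  map_comp ψ φ x := by
    change M.map (Burn.prod (Burn.comp ψ φ) (Burn.id X)) x =
      M.map (Burn.prod ψ (Burn.id X)) (M.map (Burn.prod φ (Burn.id X)) x)
    rw [← M.map_comp, Burn.prod_comp, Burn.comp_id]
  lact {G H} := AddMonoidHom.mk'
    (fun a => (M.map (Burn.iso (gassoc G H X).symm)).comp (M.lact a)) (fun _ _ => by ext; simp)
  ract {G H} := AddMonoidHom.mk'
    (fun m => (M.map (Burn.iso (gswap G X H))).comp (M.ract m)) (fun _ _ => by ext; simp)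
  lact_map φ ψ a m := by
    change M.map (Burn.prod (Burn.prod φ ψ) (Burn.id X)) (M.map (Burn.iso (gassoc _ _ X).symm) _) =
      M.map (Burn.iso (gassoc _ _ X).symm) (M.lact (A.map φ a) (M.map (Burn.prod ψ (Burn.id X)) m))
    rw [← M.lact_map, ← M.map_comp, ← M.map_comp, Burn.assoc_symm_nat]
  ract_map φ ψ m a := by
    change M.map (Burn.prod (Burn.prod φ ψ) (Burn.id X)) (M.map (Burn.iso (gswap _ X _)) _) =
      M.map (Burn.iso (gswap _ X _)) (M.ract (M.map (Burn.prod φ (Burn.id X)) m) (A.map ψ a))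
    rw [← M.ract_map, ← M.map_comp, ← M.map_comp, Burn.swap_nat]
  mul_lact {G H K} a b m := by
    change M.map (Burn.prod (Burn.iso (gassoc G H K)) (Burn.id X))
      (M.map (Burn.iso (gassoc _ K X).symm) (M.lact (A.mul a b) m)) =
      M.map (Burn.iso (gassoc _ _ X).symm) (M.lact a (M.map (Burn.iso (gassoc _ _ X).symm)
        (M.lact b m)))
    rw [M.lact_iso, ← M.mul_lact, Burn.id, Burn.prod_iso]
    simp only [M.iso_iso]
    rfl
  ract_mul {G H K} m a b := by
    change M.map (Burn.prod (Burn.iso (gassoc G H K)) (Burn.id X))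
      (M.map (Burn.iso (gswap _ X K)) (M.ract (M.map (Burn.iso (gswap G X H)) (M.ract m a)) b)) =
      M.map (Burn.iso (gswap _ X _)) (M.ract m (A.mul a b))
    rw [M.ract_iso, ← M.ract_mul, Burn.id, Burn.prod_iso]
    simp only [M.iso_iso]
    rfl
  lact_ract {G H K} a m b := by
    change M.map (Burn.prod (Burn.iso (gassoc G H K)) (Burn.id X))
      (M.map (Burn.iso (gswap _ X K)) (M.ract (M.map (Burn.iso (gassoc G H X).symm)
        (M.lact a m)) b)) =
      M.map (Burn.iso (gassoc _ _ X).symm) (M.lact a (M.map (Burn.iso (gswap _ X _)) (M.ract m b)))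
    rw [M.ract_iso, M.lact_iso, ← M.lact_ract, Burn.id, Burn.prod_iso]
    simp only [M.iso_iso]
    rfl
  one_lact {G} m := by
    change M.map (Burn.prod (Burn.iso (gleft G)) (Burn.id X))
      (M.map (Burn.iso (gassoc _ _ X).symm) (M.lact A.one m)) = m
    rw [Burn.id, Burn.prod_iso, M.iso_iso]
    exact M.one_lact m
  ract_one {G} m := by
    change M.map (Burn.prod (Burn.iso (gright G)) (Burn.id X))
      (M.map (Burn.iso (gswap _ X _)) (M.ract m A.one)) = m
    rw [Burn.id, Burn.prod_iso, M.iso_iso]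
    exact M.ract_one m

/-- Naturality of the shift of a bimodule: a morphism `φ` from `X` to `Y` in the biset category
induces a morphism of bimodules `M(- × X) → M(- × Y)`. -/
def Bimodule.shiftMap (φ : Burn Y X) : Bimodule.Hom (M.shift X) (M.shift Y) where
  app G := M.map (Burn.prod (Burn.id G) φ)
  naturality {H G} ψ (m : M.obj (gprod G X)) := by
    change M.map _ (M.map (Burn.prod ψ (Burn.id X)) m) = M.map (Burn.prod ψ (Burn.id Y)) (M.map _ m)
    rw [← M.map_comp, ← M.map_comp, Burn.prod_comp, Burn.prod_comp]
    simp only [Burn.id_comp, Burn.comp_id]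
  map_lact {G H} a (m : M.obj (gprod H X)) := by
    change M.map _ (M.map (Burn.iso (gassoc G H X).symm) (M.lact a m)) =
      M.map (Burn.iso (gassoc G H Y).symm) (M.lact a (M.map _ m))
    nth_rewrite 2 [← A.map_id G a]
    rw [← M.lact_map, ← M.map_comp, ← M.map_comp, Burn.assoc_symm_nat, Burn.prod_id]
  map_ract {G H} (m : M.obj (gprod G X)) a := by
    change M.map _ (M.map (Burn.iso (gswap G X H)) (M.ract m a)) =
      M.map (Burn.iso (gswap G Y H)) (M.ract (M.map _ m) a)
    nth_rewrite 2 [← A.map_id H a]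
    rw [← M.ract_map, ← M.map_comp, ← M.map_comp, Burn.swap_nat, Burn.prod_id]

/-- Composition of derivations with a morphism of bimodules. -/
def Der.push {M : Bimodule.{u, v} A} {N : Bimodule.{u, w} A} (p : M.Hom N) : Der M →+ Der N :=
  AddMonoidHom.mk' (fun d => ⟨fun G => (p.app G).comp (d.1 G),
      fun H G φ a => by simp [d.2.1, p.naturality],
      fun G H a b => by simp [d.2.2, p.map_lact, p.map_ract]⟩)
    (fun d d' => by
      apply Subtype.ext
      funext G
      ext a
      simp)

/-- The group of inner derivations from `A` to `M`, inside the group of derivations. -/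
def Inn : AddSubgroup (Der M) := (innerDer M).range.addSubgroupOf (Der M)

theorem Inn.push_mem {M : Bimodule.{u, v} A} {N : Bimodule.{u, w} A} (p : M.Hom N) :
    Inn M ≤ (Inn N).comap (Der.push p) := by
  rintro d ⟨m, hm⟩
  refine ⟨p.app _ m, ?_⟩
  funext G
  ext a
  have h : innerDer M m G a = d.1 G a := by rw [hm]; rfl
  change innerDer N (p.app _ m) G a = p.app G (d.1 G a)
  rw [← h]
  simp [innerDer, p.naturality, p.map_lact, p.map_ract]

/-- The first Hochschild cohomology functor of `A` with values in `M`: its value at `X` is the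
quotient of the group of derivations `A → M(- × X)` by the subgroup of inner derivations. -/
def HH1 : BisetFunctor.{max 1 u v} where
  obj X := Der (M.shift X) ⧸ Inn (M.shift X)
  map {Y X} := AddMonoidHom.mk'
    (fun φ => QuotientAddGroup.map (Inn (M.shift X)) (Inn (M.shift Y))
      (Der.push (M.shiftMap φ)) (Inn.push_mem _))
    (fun φ ψ => by
      apply QuotientAddGroup.addMonoidHom_ext
      ext d
      apply congrArg (QuotientAddGroup.mk (s := Inn (M.shift Y)))
      apply Subtype.ext
      funext G
      ext a
      simp [Der.push, Bimodule.shiftMap]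
      rfl)
  map_id X x := by
    induction x using QuotientAddGroup.induction_on with
    | H d =>
    apply congrArg (QuotientAddGroup.mk (s := Inn (M.shift X)))
    apply Subtype.ext
    funext G
    ext a
    change M.map (Burn.prod (Burn.id G) (Burn.id X)) (d.1 G a) = d.1 G a
    rw [Burn.prod_id]
    exact M.map_id _ _
  map_comp {Z Y X} ψ φ x := by
    induction x using QuotientAddGroup.induction_on with
    | H d =>
    apply congrArg (QuotientAddGroup.mk (s := Inn (M.shift Z)))
    apply Subtype.ext
    funext G
    ext a
    change M.map (Burn.prod (Burn.id G) (Burn.comp ψ φ)) (d.1 G a) =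
      M.map (Burn.prod (Burn.id G) ψ) (M.map (Burn.prod (Burn.id G) φ) (d.1 G a))
    refine Eq.trans ?_ (M.map_comp _ _ _)
    rw [Burn.prod_comp, Burn.id_comp]

end Shift

/-! ### The tensor product of biset functors and separability -/

/-- The generating symbols `[m ⊗ n]_{D, D', f}` of the tensor product `M ⊗ N` at `K`. -/
structure TensSymbol (M : BisetFunctor.{u}) (N : BisetFunctor.{v}) (K : FiniteGrp.{0}) where
  left : FiniteGrp.{0}
  right : FiniteGrp.{0}
  m : M.obj left
  n : N.obj right
  f : Burn K (gprod left right)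

/-- The defining relations of the tensor product of two biset functors (Day convolution):
additivity in `m`, `n` and `f`, and
`[m ⊗ n]_{D, D', f ∘ (α × β)} = [M(α) m ⊗ N(β) n]_{D₁, D₁', f}`. -/
inductive TensRel (M : BisetFunctor.{u}) (N : BisetFunctor.{v}) (K : FiniteGrp.{0}) :
    FreeAbelianGroup (TensSymbol M N K) → Prop
  | add_left (D D' : FiniteGrp.{0}) (m m' : M.obj D) (n : N.obj D') (f : Burn K (gprod D D')) :
      TensRel M N K (FreeAbelianGroup.of ⟨D, D', m + m', n, f⟩ -
        FreeAbelianGroup.of ⟨D, D', m, n, f⟩ - FreeAbelianGroup.of ⟨D, D', m', n, f⟩)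
  | add_right (D D' : FiniteGrp.{0}) (m : M.obj D) (n n' : N.obj D') (f : Burn K (gprod D D')) :
      TensRel M N K (FreeAbelianGroup.of ⟨D, D', m, n + n', f⟩ -
        FreeAbelianGroup.of ⟨D, D', m, n, f⟩ - FreeAbelianGroup.of ⟨D, D', m, n', f⟩)
  | add_arrow (D D' : FiniteGrp.{0}) (m : M.obj D) (n : N.obj D') (f f' : Burn K (gprod D D')) :
      TensRel M N K (FreeAbelianGroup.of ⟨D, D', m, n, f + f'⟩ -
        FreeAbelianGroup.of ⟨D, D', m, n, f⟩ - FreeAbelianGroup.of ⟨D, D', m, n, f'⟩)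
  | balanced (D D' D₁ D₁' : FiniteGrp.{0}) (α : Burn D₁ D) (β : Burn D₁' D') (m : M.obj D)
      (n : N.obj D') (f : Burn K (gprod D₁ D₁')) :
      TensRel M N K (FreeAbelianGroup.of ⟨D, D', m, n, Burn.comp f (Burn.prod α β)⟩ -
        FreeAbelianGroup.of ⟨D₁, D₁', M.map α m, N.map β n, f⟩)

/-- The value at `K` of the tensor product `M ⊗ N` of two biset functors. -/
def Tens (M : BisetFunctor.{u}) (N : BisetFunctor.{v}) (K : FiniteGrp.{0}) : Type (max 1 u v) :=
  FreeAbelianGroup (TensSymbol M N K) ⧸ AddSubgroup.closure {x | TensRel M N K x}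

instance (M : BisetFunctor.{u}) (N : BisetFunctor.{v}) (K : FiniteGrp.{0}) :
    AddCommGroup (Tens M N K) :=
  inferInstanceAs (AddCommGroup (FreeAbelianGroup (TensSymbol M N K) ⧸
    AddSubgroup.closure {x | TensRel M N K x}))

namespace Tens

variable {M : BisetFunctor.{u}} {N : BisetFunctor.{v}} {K D D' D₁ D₁' : FiniteGrp.{0}}

/-- The element `[m ⊗ n]_{D, D', f}` of `(M ⊗ N)(K)`. -/
def mk (m : M.obj D) (n : N.obj D') (f : Burn K (gprod D D')) : Tens M N K :=
  QuotientAddGroup.mk (FreeAbelianGroup.of ⟨D, D', m, n, f⟩)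

theorem rel {x : FreeAbelianGroup (TensSymbol M N K)} (h : TensRel M N K x) :
    (QuotientAddGroup.mk x : Tens M N K) = 0 :=
  (QuotientAddGroup.eq_zero_iff x).2 (AddSubgroup.subset_closure h)

theorem add_left (m m' : M.obj D) (n : N.obj D') (f : Burn K (gprod D D')) :
    mk (m + m') n f = mk m n f + mk m' n f := by
  rw [← sub_eq_zero, ← sub_sub]
  exact rel (.add_left D D' m m' n f)

theorem add_right (m : M.obj D) (n n' : N.obj D') (f : Burn K (gprod D D')) :
    mk m (n + n') f = mk m n f + mk m n' f := by
  rw [← sub_eq_zero, ← sub_sub]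
  exact rel (.add_right D D' m n n' f)

theorem add_arrow (m : M.obj D) (n : N.obj D') (f f' : Burn K (gprod D D')) :
    mk m n (f + f') = mk m n f + mk m n f' := by
  rw [← sub_eq_zero, ← sub_sub]
  exact rel (.add_arrow D D' m n f f')

theorem balanced (α : Burn D₁ D) (β : Burn D₁' D') (m : M.obj D) (n : N.obj D')
    (f : Burn K (gprod D₁ D₁')) :
    mk (M.map α m) (N.map β n) f = mk m n (Burn.comp f (Burn.prod α β)) := by
  symm
  rw [← sub_eq_zero]
  exact rel (.balanced D D' D₁ D₁' α β m n f)

theorem balanced_left (α : Burn D₁ D) (m : M.obj D) (n : N.obj D') (f : Burn K (gprod D₁ D')) :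
    mk (M.map α m) n f = mk m n (Burn.comp f (Burn.prod α (Burn.id D'))) := by
  rw [← balanced, N.map_id]

theorem balanced_right (β : Burn D₁' D') (m : M.obj D) (n : N.obj D') (f : Burn K (gprod D D₁')) :
    mk m (N.map β n) f = mk m n (Burn.comp f (Burn.prod (Burn.id D) β)) := by
  rw [← balanced, M.map_id]

theorem ind {P : Tens M N K → Prop} (h0 : P 0)
    (ho : ∀ (D D' : FiniteGrp.{0}) (m : M.obj D) (n : N.obj D') (f : Burn K (gprod D D')),
      P (mk m n f))
    (hn : ∀ x, P x → P (-x)) (ha : ∀ x y, P x → P y → P (x + y)) (x : Tens M N K) : P x := by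
  induction x using QuotientAddGroup.induction_on with
  | H z =>
    induction z using FreeAbelianGroup.induction_on with
    | zero => exact h0
    | of s => exact ho s.left s.right s.m s.n s.f
    | neg s h => exact hn _ h
    | add x y hx hy => exact ha _ _ hx hy

/-- The universal property of `(M ⊗ N)(K)`. -/
def lift {X : Type*} [AddCommGroup X]
    (p : ∀ D D' : FiniteGrp.{0}, M.obj D → N.obj D' → Burn K (gprod D D') → X)
    (h1 : ∀ D D' m m' n f, p D D' (m + m') n f = p D D' m n f + p D D' m' n f)
    (h2 : ∀ D D' m n n' f, p D D' m (n + n') f = p D D' m n f + p D D' m n' f)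
    (h3 : ∀ D D' m n f f', p D D' m n (f + f') = p D D' m n f + p D D' m n f')
    (h4 : ∀ (D D' D₁ D₁' : FiniteGrp.{0}) (α : Burn D₁ D) (β : Burn D₁' D') m n f,
      p D D' m n (Burn.comp f (Burn.prod α β)) = p D₁ D₁' (M.map α m) (N.map β n) f) :
    Tens M N K →+ X :=
  QuotientAddGroup.lift _ (FreeAbelianGroup.lift fun s => p s.left s.right s.m s.n s.f) (by
    rw [AddSubgroup.closure_le]
    intro x hx
    cases hx with
    | add_left D D' m m' n f => simp [h1]
    | add_right D D' m n n' f => simp [h2]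
    | add_arrow D D' m n f f' => simp [h3]
    | balanced D D' D₁ D₁' α β m n f => simp [h4])

@[simp] theorem lift_mk {X : Type*} [AddCommGroup X]
    (p : ∀ D D' : FiniteGrp.{0}, M.obj D → N.obj D' → Burn K (gprod D D') → X) (h1 h2 h3 h4)
    (m : M.obj D) (n : N.obj D') (f : Burn K (gprod D D')) :
    lift p h1 h2 h3 h4 (mk m n f) = p D D' m n f := by
  change FreeAbelianGroup.lift _ (FreeAbelianGroup.of _) = _
  simp

theorem hom_ext {X : Type*} [AddCommGroup X] {s t : Tens M N K →+ X}
    (h : ∀ (D D' : FiniteGrp.{0}) (m : M.obj D) (n : N.obj D') (f : Burn K (gprod D D')),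
      s (mk m n f) = t (mk m n f)) : s = t := by
  ext x
  induction x using ind with
  | h0 => simp
  | ho D D' m n f => exact h D D' m n f
  | hn x hx => simp [hx]
  | ha x y hx hy => simp [hx, hy]

/-- The action of a morphism of the biset category on a tensor product of biset functors:
`[m ⊗ n]_{D, D', f} ↦ [m ⊗ n]_{D, D', ψ ∘ f}`. -/
def map {K' : FiniteGrp.{0}} : Burn K' K →+ Tens M N K →+ Tens M N K' :=
  AddMonoidHom.mk'
    (fun ψ => lift (fun _ _ m n f => mk m n (Burn.comp ψ f))
      (fun _ _ _ _ _ _ => by rw [add_left]) (fun _ _ _ _ _ _ => by rw [add_right])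
      (fun _ _ _ _ _ _ => by rw [map_add, add_arrow])
      (fun _ _ _ _ α β m n f => by rw [balanced, Burn.comp_assoc]))
    (fun ψ ψ' => hom_ext fun D D' m n f => by
      simp only [AddMonoidHom.add_apply, lift_mk, map_add, add_arrow])

variable {A : GreenFunctor.{u}} {G H L : FiniteGrp.{0}}

/-- The left action of `A` on `A ⊗ A`:
`a × [b ⊗ c]_{D, D', f} = [(a × b) ⊗ c]_{L × D, D', L × f}`. -/
def lact : A.obj L →+ Tens A.toBisetFunctor A.toBisetFunctor K →+
    Tens A.toBisetFunctor A.toBisetFunctor (gprod L K) :=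
  AddMonoidHom.mk'
    (fun a => lift (fun D D' b c f => mk (A.mul a b) c
        (Burn.comp (Burn.prod (Burn.id L) f) (Burn.iso (gassoc L D D'))))
      (fun _ _ _ _ _ _ => by rw [map_add, add_left]) (fun _ _ _ _ _ _ => by rw [add_right])
      (fun _ _ _ _ _ _ => by rw [map_add, map_add, AddMonoidHom.add_apply, add_arrow])
      (fun D D' D₁ D₁' α β b c f => by
        nth_rewrite 2 [← A.map_id L a]
        rw [← A.mul_map, balanced, Burn.comp_assoc, Burn.assoc_nat, ← Burn.comp_assoc,
          Burn.prod_comp, Burn.comp_id]))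
    (fun a a' => hom_ext fun D D' b c f => by
      simp only [AddMonoidHom.add_apply, lift_mk, map_add, add_left])

/-- The right action of `A` on `A ⊗ A`:
`[b ⊗ c]_{D, D', f} × a = [b ⊗ (c × a)]_{D, D' × L, f × L}`. -/
def ract : Tens A.toBisetFunctor A.toBisetFunctor K →+ A.obj L →+
    Tens A.toBisetFunctor A.toBisetFunctor (gprod K L) :=
  AddMonoidHom.flip <| AddMonoidHom.mk'
    (fun a => lift (fun D D' b c f => mk b (A.mul c a)
        (Burn.comp (Burn.prod f (Burn.id L)) (Burn.iso (gassoc D D' L).symm)))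
      (fun _ _ _ _ _ _ => by rw [add_left])
      (fun _ _ _ _ _ _ => by rw [map_add, AddMonoidHom.add_apply, add_right])
      (fun _ _ _ _ _ _ => by
        rw [map_add, AddMonoidHom.add_apply, map_add, AddMonoidHom.add_apply, add_arrow])
      (fun D D' D₁ D₁' α β b c f => by
        nth_rewrite 2 [← A.map_id L a]
        rw [← A.mul_map, balanced, Burn.comp_assoc, Burn.assoc_symm_nat, ← Burn.comp_assoc,
          Burn.prod_comp, Burn.comp_id]))
    (fun a a' => hom_ext fun D D' b c f => by
      simp only [AddMonoidHom.add_apply, lift_mk, map_add, add_right])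

@[simp] theorem map_mk (ψ : Burn H K) (m : M.obj D) (n : N.obj D') (f : Burn K (gprod D D')) :
    map ψ (mk m n f) = mk m n (Burn.comp ψ f) := by
  simp only [map, AddMonoidHom.mk'_apply, lift_mk]

@[simp] theorem lact_mk (a : A.obj L) (b : A.obj D) (c : A.obj D') (f : Burn K (gprod D D')) :
    lact a (mk (M := A.toBisetFunctor) (N := A.toBisetFunctor) b c f) = mk (A.mul a b) c
      (Burn.comp (Burn.prod (Burn.id L) f) (Burn.iso (gassoc L D D'))) := by
  simp only [lact, AddMonoidHom.mk'_apply, lift_mk]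

@[simp] theorem ract_mk (a : A.obj L) (b : A.obj D) (c : A.obj D') (f : Burn K (gprod D D')) :
    ract (mk (M := A.toBisetFunctor) (N := A.toBisetFunctor) b c f) a = mk b (A.mul c a)
      (Burn.comp (Burn.prod f (Burn.id L)) (Burn.iso (gassoc D D' L).symm)) := by
  simp only [ract, AddMonoidHom.flip_apply, AddMonoidHom.mk'_apply, lift_mk]

end Tens

/-- The `(A, A)`-bimodule `A ⊗ A`. -/
def GreenFunctor.tensSelf (A : GreenFunctor.{u}) : Bimodule.{u, max 1 u} A where
  obj := Tens A.toBisetFunctor A.toBisetFunctor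
  map := Tens.map
  map_id G x := DFunLike.congr_fun (f := Tens.map (Burn.id G)) (g := AddMonoidHom.id _)
    (Tens.hom_ext fun D D' m n f => by simp [Burn.id_comp]) x
  map_comp ψ φ x := DFunLike.congr_fun (f := Tens.map (Burn.comp ψ φ))
    (g := (Tens.map ψ).comp (Tens.map φ))
    (Tens.hom_ext fun D D' m n f => by simp [Burn.comp_assoc]) x
  lact := Tens.lact
  ract := Tens.ract
  lact_map {L L' K K'} φ ψ a x := by
    induction x using Tens.ind with
    | h0 => simp
    | hn x hx => simp [hx]
    | ha x y hx hy => simp [hx, hy]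
    | ho D D' b c f =>
      have h : A.mul (A.map φ a) b = A.map (Burn.prod φ (Burn.id D)) (A.mul a b) := by
        rw [A.mul_map, A.map_id]
      rw [Tens.lact_mk, Tens.map_mk, Tens.map_mk, Tens.lact_mk, h, Tens.balanced_left,
        Burn.comp_assoc, Burn.assoc_nat, ← Burn.comp_assoc, ← Burn.comp_assoc, Burn.prod_comp,
        Burn.prod_comp, Burn.prod_id]
      simp only [Burn.comp_id, Burn.id_comp]
  ract_map {L L' K K'} φ ψ x a := by
    induction x using Tens.ind with
    | h0 => simp
    | hn x hx => simp [hx]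
    | ha x y hx hy => simp [hx, hy]
    | ho D D' b c f =>
      have h : A.mul c (A.map ψ a) = A.map (Burn.prod (Burn.id D') ψ) (A.mul c a) := by
        rw [A.mul_map, A.map_id]
      rw [Tens.ract_mk, Tens.map_mk, Tens.map_mk, Tens.ract_mk, h, Tens.balanced_right,
        Burn.comp_assoc, Burn.assoc_symm_nat, ← Burn.comp_assoc, ← Burn.comp_assoc,
        Burn.prod_comp, Burn.prod_comp, Burn.prod_id]
      simp only [Burn.comp_id, Burn.id_comp]
  mul_lact {G H K} a b x := by
    induction x using Tens.ind with
    | h0 => simp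
    | hn x hx => simp [hx]
    | ha x y hx hy => simp [hx, hy]
    | ho D D' c d f =>
      rw [Tens.lact_mk, Tens.lact_mk, Tens.lact_mk, Tens.map_mk, ← A.mul_assoc,
        Tens.balanced_left, ← Burn.comp_assoc, ← Burn.prod_id, Burn.assoc_nat]
      have h : Burn.prod (Burn.id G) (Burn.comp (Burn.prod (Burn.id H) f)
          (Burn.iso (gassoc H D D'))) = Burn.comp (Burn.prod (Burn.id G) (Burn.prod (Burn.id H) f))
          (Burn.prod (Burn.id G) (Burn.iso (gassoc H D D'))) := by
        rw [Burn.prod_comp, Burn.id_comp]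
      rw [h]
      simp only [Burn.comp_assoc]
      simp only [Burn.id, Burn.prod_iso, Burn.iso_comp_iso]
      rfl
  ract_mul {G H K} x a b := by
    induction x using Tens.ind with
    | h0 => simp
    | hn x hx => simp [hx]
    | ha x y hx hy => simp [hx, hy]
    | ho D D' c d f =>
      rw [Tens.ract_mk, Tens.ract_mk, Tens.ract_mk, Tens.map_mk, ← A.mul_assoc,
        Tens.balanced_right]
      have h : Burn.prod (Burn.comp (Burn.prod f (Burn.id H))
          (Burn.iso (gassoc D D' H).symm)) (Burn.id K) =
          Burn.comp (Burn.prod (Burn.prod f (Burn.id H)) (Burn.id K))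
          (Burn.prod (Burn.iso (gassoc D D' H).symm) (Burn.id K)) := by
        rw [Burn.prod_comp, Burn.id_comp]
      rw [h, Burn.comp_assoc, ← Burn.comp_assoc, Burn.assoc_nat, Burn.prod_id]
      simp only [Burn.comp_assoc]
      simp only [Burn.id, Burn.prod_iso, Burn.iso_comp_iso]
      rfl
  lact_ract {G H K} a x b := by
    induction x using Tens.ind with
    | h0 => simp
    | hn x hx => simp [hx]
    | ha x y hx hy => simp [hx, hy]
    | ho D D' c d f =>
      rw [Tens.lact_mk, Tens.ract_mk, Tens.ract_mk, Tens.lact_mk, Tens.map_mk]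
      have h : Burn.prod (Burn.comp (Burn.prod (Burn.id G) f)
          (Burn.iso (gassoc G D D'))) (Burn.id K) =
          Burn.comp (Burn.prod (Burn.prod (Burn.id G) f) (Burn.id K))
          (Burn.prod (Burn.iso (gassoc G D D')) (Burn.id K)) := by
        rw [Burn.prod_comp, Burn.id_comp]
      have h' : Burn.prod (Burn.id G) (Burn.comp (Burn.prod f (Burn.id K))
          (Burn.iso (gassoc D D' K).symm)) =
          Burn.comp (Burn.prod (Burn.id G) (Burn.prod f (Burn.id K)))
          (Burn.prod (Burn.id G) (Burn.iso (gassoc D D' K).symm)) := by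
        rw [Burn.prod_comp, Burn.id_comp]
      rw [h, h', Burn.comp_assoc, ← Burn.comp_assoc, Burn.assoc_nat]
      simp only [Burn.comp_assoc]
      simp only [Burn.id, Burn.prod_iso, Burn.iso_comp_iso]
      rfl
  one_lact {G} x := by
    induction x using Tens.ind with
    | h0 => simp
    | hn x hx => simp [hx]
    | ha x y hx hy => simp [hx, hy]
    | ho D D' c d f =>
      nth_rewrite 2 [← A.one_mul c]
      rw [Tens.lact_mk, Tens.map_mk, Tens.balanced_left, ← Burn.comp_assoc, Burn.left_nat,
        Burn.comp_assoc, Burn.iso_comp_iso, Burn.id, Burn.prod_iso]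
      rfl
  ract_one {G} x := by
    induction x using Tens.ind with
    | h0 => simp
    | hn x hx => simp [hx]
    | ha x y hx hy => simp [hx, hy]
    | ho D D' c d f =>
      nth_rewrite 2 [← A.mul_one d]
      rw [Tens.ract_mk, Tens.map_mk, Tens.balanced_right, ← Burn.comp_assoc, Burn.right_nat,
        Burn.comp_assoc, Burn.iso_comp_iso, Burn.id, Burn.prod_iso]
      rfl

/-- The product map `μ : A ⊗ A → A` at `K`, sending `[a ⊗ b]_{D, D', f}` to `A(f)(a × b)`. -/
def Tens.mu {A : GreenFunctor.{u}} {K : FiniteGrp.{0}} :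
    Tens A.toBisetFunctor A.toBisetFunctor K →+ A.obj K :=
  Tens.lift (fun D D' a b f => A.map f (A.mul a b))
    (fun _ _ _ _ _ _ => by simp) (fun _ _ _ _ _ _ => by simp) (fun _ _ _ _ _ _ => by simp)
    (fun _ _ _ _ α β a b f => by rw [A.map_comp, A.mul_map])

@[simp] theorem Tens.mu_mk {A : GreenFunctor.{u}} {K D D' : FiniteGrp.{0}} (a : A.obj D)
    (b : A.obj D') (f : Burn K (gprod D D')) :
    Tens.mu (Tens.mk (M := A.toBisetFunctor) (N := A.toBisetFunctor) a b f) =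
      A.map f (A.mul a b) := by
  simp only [Tens.mu, Tens.lift_mk]

/-- The product map `μ : A ⊗ A → A`, as a morphism of `(A, A)`-bimodules. -/
def GreenFunctor.mu (A : GreenFunctor.{u}) : A.tensSelf.Hom A.regular where
  app K := Tens.mu
  naturality {H G} φ x := by
    change Tens.mu (Tens.map φ x) = A.map φ (Tens.mu x)
    induction x using Tens.ind with
    | h0 => simp
    | hn x hx => simp [hx]
    | ha x y hx hy => simp [hx, hy]
    | ho D D' b c f => simp [A.map_comp]
  map_lact {G H} a x := by
    change Tens.mu (Tens.lact a x) = A.mul a (Tens.mu x)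
    induction x using Tens.ind with
    | h0 => simp
    | hn x hx => simp [hx]
    | ha x y hx hy => simp [hx, hy]
    | ho D D' b c f => simp [A.map_comp, A.mul_assoc, A.mul_map, A.map_id]
  map_ract {G H} x a := by
    change Tens.mu (Tens.ract x a) = A.mul (Tens.mu x) a
    induction x using Tens.ind with
    | h0 => simp
    | hn x hx => simp [hx]
    | ha x y hx hy => simp [hx, hy]
    | ho D D' b c f =>
      rw [Tens.ract_mk, Tens.mu_mk, Tens.mu_mk]
      rw [← A.mul_assoc, ← A.map_comp, Burn.comp_assoc, Burn.iso_comp_iso,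
        MulEquiv.self_trans_symm, A.map_comp]
      change A.map _ (A.map (Burn.id _) _) = _
      rw [A.map_id, A.mul_map, A.map_id]

/-- A Green biset functor `A` is separable if the product map `μ : A ⊗ A → A` is split surjective
as a morphism of `(A, A)`-bimodules. -/
def GreenFunctor.IsSeparable (A : GreenFunctor.{u}) : Prop :=
  ∃ σ : A.regular.Hom A.tensSelf, ∀ (G : FiniteGrp.{0}) (a : A.obj G),
    A.mu.app G (σ.app G a) = a

/-- Projectivity of a bimodule: every morphism to the target of a surjective morphism of
bimodules lifts. -/
def Bimodule.IsProjective {A : GreenFunctor.{u}} (P : Bimodule.{u, v} A) : Prop :=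
  ∀ (M N : Bimodule.{u, v} A) (p : M.Hom N) (f : P.Hom N),
    (∀ G : FiniteGrp.{0}, Function.Surjective (p.app G)) →
    ∃ g : P.Hom M, ∀ (G : FiniteGrp.{0}) (x : P.obj G), p.app G (g.app G x) = f.app G x

/-! ### Complex characters -/

instance (G : FiniteGrp.{0}) : Fintype G := Fintype.ofFinite G

theorem sum_gprod {X : Type*} [AddCommMonoid X] (G H : FiniteGrp.{0}) (f : gprod G H → X) :
    ∑ x, f x = ∑ g : G, ∑ h : H, f (g, h) := by
  have h : ∀ i : Fintype (G × H), (@Finset.univ _ i).sum (fun x : G × H => f x) =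
      ∑ g : G, ∑ h : H, f (g, h) := by
    intro i
    rw [Subsingleton.elim i (instFintypeProd G H)]
    exact Fintype.sum_prod_type (fun x : G × H => f x)
  exact h _

/-- The group of virtual complex characters of `G`, inside the functions `G → ℂ`: the additive
subgroup generated by the characters of the finite dimensional complex representations. -/
def charGroup (G : FiniteGrp.{0}) : AddSubgroup (G → ℂ) :=
  AddSubgroup.closure {χ | ∃ (V : Type) (_ : AddCommGroup V) (_ : Module ℂ V)
    (_ : Module.Finite ℂ V) (ρ : Representation ℂ G V), ρ.character = χ}

theorem char_mem {G : FiniteGrp.{0}} {V : Type} [AddCommGroup V] [Module ℂ V] [Module.Finite ℂ V]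
    (ρ : Representation ℂ G V) : ρ.character ∈ charGroup G :=
  AddSubgroup.subset_closure ⟨V, _, _, ‹_›, ρ, rfl⟩

/-- To map virtual characters to virtual characters it suffices to map characters to
virtual characters. -/
theorem charGroup_le {G : FiniteGrp.{0}} {X : Type*} [AddCommGroup X] (t : (G → ℂ) →+ X)
    (S : AddSubgroup X)
    (h : ∀ (V : Type) [AddCommGroup V] [Module ℂ V] [Module.Finite ℂ V]
      (ρ : Representation ℂ G V), t ρ.character ∈ S) {χ : G → ℂ} (hχ : χ ∈ charGroup G) :
    t χ ∈ S := by
  have : charGroup G ≤ S.comap t := by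
    rw [charGroup, AddSubgroup.closure_le]
    rintro _ ⟨V, _, _, _, ρ, rfl⟩
    exact h V ρ
  exact this hχ

theorem charGroup_conj {G : FiniteGrp.{0}} {χ : G → ℂ} (hχ : χ ∈ charGroup G) (g h : G) :
    χ (h * g) = χ (g * h) := by
  have := charGroup_le ((Pi.evalAddMonoidHom (fun _ : G => ℂ) (h * g)) -
    (Pi.evalAddMonoidHom (fun _ : G => ℂ) (g * h))) ⊥
    (fun V _ _ _ ρ => by simp [ρ.char_mul_comm g h]) hχ
  simpa [sub_eq_zero] using this

/-! #### Tensoring with permutation bimodules -/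

section TensorRep

variable {H G K : FiniteGrp.{0}} (U : Biset H G)

/-- The complex vector space `ℂ U` with basis `U`. -/
def Biset.Lin : Type := U.carrier →₀ ℂ

instance : AddCommGroup U.Lin := inferInstanceAs (AddCommGroup (U.carrier →₀ ℂ))

instance : Module ℂ U.Lin := inferInstanceAs (Module ℂ (U.carrier →₀ ℂ))

/-- The basis `U` of `ℂ U`. -/
def Biset.basis : Module.Basis U.carrier ℂ U.Lin := Finsupp.basisSingleOne

instance : Module.Finite ℂ U.Lin := Module.Finite.of_basis U.basis

/-- The endomorphism of `ℂ U` extending a map `U → U`. -/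
def Biset.linMap (s : U.carrier → U.carrier) : U.Lin →ₗ[ℂ] U.Lin :=
  U.basis.constr ℂ fun x => U.basis (s x)

@[simp] theorem Biset.linMap_basis (s : U.carrier → U.carrier) (x : U.carrier) :
    U.linMap s (U.basis x) = U.basis (s x) := by
  simp [Biset.linMap]

theorem Biset.trace_linMap (s : U.carrier → U.carrier) :
    LinearMap.trace ℂ U.Lin (U.linMap s) = Nat.card {x // s x = x} := by
  classical
  have := Fintype.ofFinite U.carrier
  rw [LinearMap.trace_eq_matrix_trace ℂ U.basis, Matrix.trace, Nat.card_eq_fintype_card,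
    Fintype.card_subtype]
  simp [LinearMap.toMatrix_apply, Finsupp.single_apply]

/-- The permutation representation of `H` on `ℂ U`. -/
def Biset.leftRep : Representation ℂ H U.Lin where
  toFun h := U.linMap (U.l h)
  map_one' := U.basis.ext fun x => by simp [U.one_l]
  map_mul' h h' := U.basis.ext fun x => by simp [U.mul_l]

/-- The permutation representation of `G` on `ℂ U`, for the left action `g • x = x g⁻¹`. -/
def Biset.rightRep : Representation ℂ G U.Lin where
  toFun g := U.linMap (fun x => U.r x g⁻¹)
  map_one' := U.basis.ext fun x => by simp [U.r_one]
  map_mul' h h' := U.basis.ext fun x => by simp [U.r_mul]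

@[simp] theorem Biset.leftRep_basis (h : H) (x : U.carrier) :
    U.leftRep h (U.basis x) = U.basis (U.l h x) := U.linMap_basis _ _

@[simp] theorem Biset.rightRep_basis (g : G) (x : U.carrier) :
    U.rightRep g (U.basis x) = U.basis (U.r x g⁻¹) := U.linMap_basis _ _

variable {V : Type} [AddCommGroup V] [Module ℂ V] (ρ : Representation ℂ G V)

open TensorProduct in
/-- The subspace of `ℂ U ⊗_ℂ V` spanned by the elements `x g ⊗ v - x ⊗ g v`. -/
def Biset.balSub : Submodule ℂ (U.Lin ⊗[ℂ] V) :=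
  Submodule.span ℂ {y | ∃ (x : U.carrier) (g : G) (v : V),
    y = U.basis (U.r x g) ⊗ₜ[ℂ] v - U.basis x ⊗ₜ[ℂ] ρ g v}

open TensorProduct in
/-- The space `ℂ U ⊗_{ℂ G} V`. -/
abbrev Biset.TensorSpace : Type := (U.Lin ⊗[ℂ] V) ⧸ U.balSub ρ

open TensorProduct in
theorem Biset.lin_ext {W : Type*} [AddCommGroup W] [Module ℂ W] {s t : U.Lin ⊗[ℂ] V →ₗ[ℂ] W}
    (h : ∀ x v, s (U.basis x ⊗ₜ v) = t (U.basis x ⊗ₜ v)) : s = t :=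
  TensorProduct.ext (U.basis.ext fun x => LinearMap.ext fun v => h x v)

/-- The left multiplication by `h` on `ℂ U ⊗_{ℂ G} V`. -/
def Biset.tensorMul (h : H) : U.TensorSpace ρ →ₗ[ℂ] U.TensorSpace ρ :=
  Submodule.mapQ _ _ (TensorProduct.map (U.leftRep h) LinearMap.id) (by
    rw [Biset.balSub, Submodule.span_le]
    rintro _ ⟨x, g, v, rfl⟩
    refine Submodule.subset_span ⟨U.l h x, g, v, ?_⟩
    simp [U.l_r])

/-- The representation of `H` on `ℂ U ⊗_{ℂ G} V`, for a representation `V` of `G`. -/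
def Biset.tensorRep : Representation ℂ H (U.TensorSpace ρ) where
  toFun h := U.tensorMul ρ h
  map_one' := by
    apply Submodule.linearMap_qext
    rw [Biset.tensorMul, Submodule.mapQ_mkQ, map_one]
    exact U.lin_ext fun x v => by simp
  map_mul' h h' := by
    apply Submodule.linearMap_qext
    rw [Module.End.mul_eq_comp, LinearMap.comp_assoc, Biset.tensorMul, Biset.tensorMul,
      Biset.tensorMul, Submodule.mapQ_mkQ, Submodule.mapQ_mkQ, ← LinearMap.comp_assoc,
      Submodule.mapQ_mkQ, map_mul]
    exact U.lin_ext fun x v => by simp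

end TensorRep

open TensorProduct in
/-- The representation `ℂ U ⊗_{ℂ G} V` has character
`h ↦ |G|⁻¹ ∑_g |{x ∈ U | h x = x g}| χ(g)`, where `χ` is the character of `V`. -/
theorem Biset.character_tensorRep {H G : FiniteGrp.{0}} (U : Biset H G) {V : Type} [AddCommGroup V]
    [Module ℂ V] [Module.Finite ℂ V] (ρ : Representation ℂ G V) (h : H) :
    (U.tensorRep ρ).character h = (Nat.card G : ℂ)⁻¹ *
      ∑ g : G, (Nat.card {x // U.l h x = U.r x g} : ℂ) * ρ.character g := by
  have hG : (Nat.card G : ℂ) ≠ 0 := Nat.cast_ne_zero.2 Nat.card_pos.ne'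
  let avg : TensorProduct ℂ U.Lin V →ₗ[ℂ] TensorProduct ℂ U.Lin V :=
    (Nat.card G : ℂ)⁻¹ • ∑ g : G, TensorProduct.map (U.rightRep g) (ρ g)
  have havg : ∀ w, avg w = (Nat.card G : ℂ)⁻¹ •
      ∑ g : G, TensorProduct.map (U.rightRep g) (ρ g) w := fun w => by simp [avg]
  let s : U.TensorSpace ρ →ₗ[ℂ] TensorProduct ℂ U.Lin V :=
    Submodule.liftQ _ avg (by
      rw [Biset.balSub, Submodule.span_le]
      rintro _ ⟨x, k, v, rfl⟩
      change avg _ = 0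
      rw [map_sub, sub_eq_zero, havg, havg]
      congr 1
      refine Fintype.sum_equiv (Equiv.mulRight k⁻¹) _ _ (fun g => ?_)
      simp [← U.r_mul, ← Module.End.mul_apply, ← map_mul])
  have hs : (U.balSub ρ).mkQ ∘ₗ s = LinearMap.id := by
    apply Submodule.linearMap_qext
    have hs' : s ∘ₗ (U.balSub ρ).mkQ = avg := Submodule.liftQ_mkQ _ _ _
    rw [LinearMap.comp_assoc, hs', LinearMap.id_comp]
    refine U.lin_ext fun x v => ?_
    have hb : ∀ g : G, (U.balSub ρ).mkQ (TensorProduct.map (U.rightRep g) (ρ g)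
        (U.basis x ⊗ₜ[ℂ] v)) = (U.balSub ρ).mkQ (U.basis x ⊗ₜ[ℂ] v) := by
      intro g
      symm
      rw [← sub_eq_zero, ← map_sub, ← LinearMap.mem_ker, Submodule.ker_mkQ]
      refine Submodule.subset_span ⟨U.r x g⁻¹, g, v, ?_⟩
      simp [← U.r_mul, U.r_one]
    change (U.balSub ρ).mkQ (avg (U.basis x ⊗ₜ[ℂ] v)) =
      (U.balSub ρ).mkQ (U.basis x ⊗ₜ[ℂ] v)
    rw [havg, map_smul, map_sum, Finset.sum_congr rfl (fun g _ => hb g), Finset.sum_const,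
      Finset.card_univ, ← Nat.card_eq_fintype_card, ← Nat.cast_smul_eq_nsmul ℂ, inv_smul_smul₀ hG]
  have hs' : s ∘ₗ (U.balSub ρ).mkQ = avg := Submodule.liftQ_mkQ _ _ _
  have hT : U.tensorMul ρ h ∘ₗ (U.balSub ρ).mkQ =
      (U.balSub ρ).mkQ ∘ₗ TensorProduct.map (U.leftRep h) LinearMap.id := Submodule.mapQ_mkQ _ _ _
  have h1 : U.tensorMul ρ h =
      ((U.balSub ρ).mkQ ∘ₗ TensorProduct.map (U.leftRep h) LinearMap.id) ∘ₗ s := by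
    rw [← hT, LinearMap.comp_assoc, hs, LinearMap.comp_id]
  have h2 : avg ∘ₗ TensorProduct.map (U.leftRep h) LinearMap.id = (Nat.card G : ℂ)⁻¹ •
      ∑ g : G, TensorProduct.map (U.rightRep g ∘ₗ U.leftRep h) (ρ g) := by
    exact U.lin_ext fun x v => by simp [havg]
  change LinearMap.trace ℂ _ (U.tensorMul ρ h) = _
  rw [h1, LinearMap.trace_comp_comm', ← LinearMap.comp_assoc, hs', h2, map_smul, map_sum,
    smul_eq_mul]
  congr 1
  refine Finset.sum_congr rfl fun g _ => ?_
  rw [LinearMap.trace_tensorProduct', Representation.character]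
  congr 1
  have : U.rightRep g ∘ₗ U.leftRep h = U.linMap (fun x => U.r (U.l h x) g⁻¹) :=
    U.basis.ext fun x => by simp
  rw [this, U.trace_linMap]
  congr 1
  refine Nat.card_congr (Equiv.subtypeEquivRight fun x => ?_)
  constructor
  · intro hx
    conv_rhs => rw [← hx]
    rw [← U.r_mul, inv_mul_cancel, U.r_one]
  · intro hx
    rw [hx, ← U.r_mul, mul_inv_cancel, U.r_one]

/-! #### The action of bisets on characters -/

/-- A counting lemma for the points of an orbit space that are fixed by a self-map. -/
theorem card_fixed_orbits {T X Q : Type*} [Group T] [Finite T] [Finite X] [Finite Q]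
    [MulAction T X] (τ : X → X) (π : X → Q) (hs : Function.Surjective π)
    (hπ : ∀ x y, π x = π y ↔ ∃ t : T, t • x = y) (P : Q → Prop)
    (hP : ∀ x, P (π x) ↔ π x = π (τ x)) :
    ∑ᶠ x : X, Nat.card {t : T // t • x = τ x} = Nat.card T * Nat.card {q // P q} := by
  classical
  have := Fintype.ofFinite X
  have := Fintype.ofFinite Q
  have horb : ∀ x y : X, π x = π y → MulAction.orbit T x = MulAction.orbit T y := by
    intro x y h
    obtain ⟨t, rfl⟩ := (hπ _ _).1 h
    exact (MulAction.orbit_eq_iff.2 ⟨t, rfl⟩).symm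
  have hprod : ∀ x : X, Nat.card (MulAction.orbit T x) * Nat.card (MulAction.stabilizer T x) =
      Nat.card T := fun x => by
    rw [← Nat.card_prod]
    exact Nat.card_congr (MulAction.orbitProdStabilizerEquivGroup T x)
  have hfib : ∀ x, Nat.card {y // π y = π x} = Nat.card (MulAction.orbit T x) := fun x =>
    Nat.card_congr (Equiv.subtypeEquivRight fun y => by
      rw [eq_comm, hπ, MulAction.mem_orbit_iff])
  have hN : ∀ x, Nat.card {t : T // t • x = τ x} =
      if P (π x) then Nat.card (MulAction.stabilizer T x) else 0 := by
    intro x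
    split_ifs with h
    · obtain ⟨t₀, ht₀⟩ := (hπ _ _).1 ((hP x).1 h)
      refine Nat.card_congr ⟨fun t => ⟨t₀⁻¹ * t.1, ?_⟩, fun t => ⟨t₀ * t.1, ?_⟩, fun t => ?_,
        fun t => ?_⟩
      · rw [MulAction.mem_stabilizer_iff, mul_smul, t.2, ← ht₀, inv_smul_smul]
      · rw [mul_smul, MulAction.mem_stabilizer_iff.1 t.2, ht₀]
      · simp
      · simp
    · have : IsEmpty {t : T // t • x = τ x} := ⟨fun t => h ((hP x).2 ((hπ _ _).2 ⟨t.1, t.2⟩))⟩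
      exact Nat.card_of_isEmpty
  rw [finsum_eq_sum_of_fintype, ← Finset.sum_fiberwise Finset.univ π]
  have hq : ∀ q, ∑ x with π x = q, Nat.card {t : T // t • x = τ x} =
      if P q then Nat.card T else 0 := by
    intro q
    obtain ⟨r, rfl⟩ := hs q
    have : ∀ x ∈ Finset.univ.filter (fun x => π x = π r), Nat.card {t : T // t • x = τ x} =
        if P (π r) then Nat.card (MulAction.stabilizer T r) else 0 := by
      intro x hx
      have hx' : π x = π r := (Finset.mem_filter.1 hx).2
      rw [hN, hx']
      congr 1
      have h1 := hprod x
      rw [horb x r hx', ← hprod r] at h1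
      have : Nonempty (MulAction.orbit T r) := ⟨⟨r, MulAction.mem_orbit_self r⟩⟩
      exact Nat.eq_of_mul_eq_mul_left (Nat.card_pos (α := MulAction.orbit T r)) h1
    rw [Finset.sum_congr rfl this, Finset.sum_const, ← Fintype.card_subtype,
      ← Nat.card_eq_fintype_card, hfib, smul_eq_mul, mul_ite, hprod, mul_zero]
  rw [Finset.sum_congr rfl fun q _ => hq q, ← Finset.sum_filter, Finset.sum_const, smul_eq_mul,
    mul_comm, ← Fintype.card_subtype, Nat.card_eq_fintype_card (α := {q // P q})]

namespace Biset

variable {H G K H' G' : FiniteGrp.{0}}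

/-- The number of elements `x` of a biset with `h x = x g`. -/
def fix (U : Biset H G) (h : H) (g : G) : ℕ := Nat.card {x // U.l h x = U.r x g}

theorem fix_sum {W U V : Biset H G} (e : W.Iso (U.sum V)) (h : H) (g : G) :
    W.fix h g = U.fix h g + V.fix h g := by
  obtain ⟨e, e1, e2⟩ := e
  rw [fix, fix, fix, ← Nat.card_sum]
  refine Nat.card_congr ((Equiv.subtypeEquiv (q := fun x => (U.sum V).l h x = (U.sum V).r x g) e
    fun x => ?_).trans (Equiv.subtypeSum.trans (Equiv.sumCongr
      (Equiv.subtypeEquivRight fun x => ?_) (Equiv.subtypeEquivRight fun x => ?_))))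
  · rw [← e1, ← e2, e.apply_eq_iff_eq]
  · exact Sum.inl_injective.eq_iff
  · exact Sum.inr_injective.eq_iff

theorem fix_prod (U : Biset H G) (V : Biset H' G') (h : gprod H H') (g : gprod G G') :
    (U.prod V).fix h g = U.fix h.1 g.1 * V.fix h.2 g.2 := by
  rw [fix, fix, fix, ← Nat.card_prod]
  exact Nat.card_congr ⟨fun x => (⟨x.1.1, congrArg Prod.fst x.2⟩, ⟨x.1.2, congrArg Prod.snd x.2⟩),
    fun x => ⟨(x.1.1, x.2.1), Prod.ext x.1.2 x.2.2⟩, fun _ => rfl, fun _ => rfl⟩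

theorem fix_comp (V : Biset K H) (U : Biset H G) (k : K) (g : G) :
    Nat.card H * (V.comp U).fix k g = ∑ h : H, V.fix k h * U.fix h g := by
  classical
  let _ : MulAction H (V.carrier × U.carrier) :=
    { smul := fun t p => (V.r p.1 t⁻¹, U.l t p.2)
      one_smul := fun p => Prod.ext
        ((congrArg (V.r p.1) inv_one).trans (V.r_one p.1)) (U.one_l p.2)
      mul_smul := fun s t p => Prod.ext
        ((congrArg (V.r p.1) (mul_inv_rev s t)).trans (V.r_mul _ _ _)) (U.mul_l _ _ _) }
  have hsm : ∀ (t : H) (p : V.carrier × U.carrier), t • p = (V.r p.1 t⁻¹, U.l t p.2) :=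
    fun _ _ => rfl
  have hinv : ∀ (v v' : V.carrier) (t : H), V.r v t⁻¹ = v' ↔ V.r v' t = v := by
    intro v v' t
    constructor
    · rintro rfl
      rw [← V.r_mul, inv_mul_cancel, V.r_one]
    · rintro rfl
      rw [← V.r_mul, mul_inv_cancel, V.r_one]
  have key := card_fixed_orbits (T := H) (fun p : V.carrier × U.carrier => (V.l k p.1, U.r p.2 g⁻¹))
    (fun p => (cmk p.1 p.2 : CompCarrier V U)) (cind fun v y => ⟨(v, y), rfl⟩)
    (fun p q => by
      rw [cmk_eq]
      refine exists_congr fun t => ?_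
      rw [hsm, Prod.ext_iff, hinv])
    (fun c => (V.comp U).l k c = (V.comp U).r c g)
    (fun p => by
      change (cmk (V.l k p.1) p.2 : CompCarrier V U) = cmk p.1 (U.r p.2 g) ↔ _
      rw [eq_comm, cmk_eq, cmk_eq]
      refine exists_congr fun t => and_congr_right fun _ => ?_
      rw [U.l_r]
      constructor
      · intro h
        have h2 := congrArg (fun z => U.r z g⁻¹) h
        simp only [← U.r_mul, mul_inv_cancel, U.r_one] at h2
        exact h2
      · intro h
        rw [h, ← U.r_mul, inv_mul_cancel, U.r_one])
  refine key.symm.trans ?_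
  have := Fintype.ofFinite V.carrier
  have := Fintype.ofFinite U.carrier
  rw [finsum_eq_sum_of_fintype, ← Equiv.sum_comp (Equiv.inv H)]
  simp only [Equiv.inv_apply, fix, ← Nat.card_prod]
  simp only [Nat.card_eq_fintype_card]
  rw [← Fintype.card_sigma, ← Fintype.card_sigma]
  refine Fintype.card_congr ⟨fun x => ⟨x.2.1, ⟨⟨x.1.1, ?_⟩, ⟨x.1.2, ?_⟩⟩⟩,
    fun x => ⟨(x.2.1.1, x.2.2.1), ⟨x.1, ?_⟩⟩, fun x => rfl, fun x => rfl⟩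
  · exact (congrArg Prod.fst x.2.2).symm
  · have := congrArg Prod.snd x.2.2
    change U.l x.2.1 x.1.2 = U.r x.1.2 g⁻¹ at this
    have h2 := congrArg (fun z => U.r (U.l x.2.1⁻¹ z) g) this
    simp only [← U.l_r, ← U.r_mul, ← U.mul_l, inv_mul_cancel, U.r_one, U.one_l] at h2
    exact h2.symm
  · rw [hsm]
    refine Prod.ext x.2.1.2.symm ?_
    have h2 := congrArg (fun z => U.r (U.l x.1 z) g⁻¹) x.2.2.2
    simp only [← U.mul_l, mul_inv_cancel, U.one_l] at h2
    rw [U.l_r, ← U.r_mul, mul_inv_cancel, U.r_one] at h2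
    exact h2.symm

end Biset

/-- The map `θ` from `B(H, G)` to the functions `H × G → ℂ`, sending a biset `U` to the character
`(h, g) ↦ |{x ∈ U | h x = x g}|` of the permutation bimodule `ℂ U`. -/
def theta {H G : FiniteGrp.{0}} : Burn H G →+ (H → G → ℂ) :=
  Burn.lift (fun U h g => (U.fix h g : ℂ)) (fun W U V e => by
    ext h g
    simp [Biset.fix_sum e])

@[simp] theorem theta_of {H G : FiniteGrp.{0}} (U : Biset H G) (h : H) (g : G) :
    theta (Burn.of U) h g = U.fix h g := by
  simp [theta]

theorem theta_comp {K H G : FiniteGrp.{0}} (x : Burn K H) (y : Burn H G) (k : K) (g : G) :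
    theta (Burn.comp x y) k g = (Nat.card H : ℂ)⁻¹ * ∑ h : H, theta x k h * theta y h g := by
  induction x using Burn.ind with
  | h0 => simp
  | hn x hx => simp [hx]
  | ha x y hx hy => simp [hx, hy, add_mul, Finset.sum_add_distrib, mul_add]
  | ho V =>
  induction y using Burn.ind with
  | h0 => simp
  | hn x hx => simp [hx]
  | ha x y hx hy => simp [hx, hy, mul_add, Finset.sum_add_distrib]
  | ho U =>
    have hH : (Nat.card H : ℂ) ≠ 0 := Nat.cast_ne_zero.2 Nat.card_pos.ne'
    rw [eq_inv_mul_iff_mul_eq₀ hH, Burn.comp_of]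
    simp only [theta_of]
    exact_mod_cast Biset.fix_comp V U k g

theorem theta_prod {H G H' G' : FiniteGrp.{0}} (x : Burn H G) (y : Burn H' G') (h : gprod H H')
    (g : gprod G G') : theta (Burn.prod x y) h g = theta x h.1 g.1 * theta y h.2 g.2 := by
  induction x using Burn.ind with
  | h0 => simp
  | hn x hx => simp [hx]
  | ha x y hx hy => simp [hx, hy, add_mul]
  | ho V =>
  induction y using Burn.ind with
  | h0 => simp
  | hn x hx => simp [hx]
  | ha x y hx hy => simp [hx, hy, mul_add]
  | ho U =>
    rw [Burn.prod_of]
    simp [Biset.fix_prod]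

/-- The action of a morphism of the biset category on functions, determined on characters by
`charMap_character`. -/
def charMap {H G : FiniteGrp.{0}} : Burn H G →+ (G → ℂ) →+ (H → ℂ) :=
  AddMonoidHom.mk' (fun φ => AddMonoidHom.mk'
      (fun χ h => (Nat.card G : ℂ)⁻¹ * ∑ g : G, theta φ h g * χ g)
      (fun χ χ' => by ext h; simp [mul_add, Finset.sum_add_distrib]))
    (fun φ ψ => by ext χ h; simp [add_mul, mul_add, Finset.sum_add_distrib])

theorem charMap_apply {H G : FiniteGrp.{0}} (φ : Burn H G) (χ : G → ℂ) (h : H) :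
    charMap φ χ h = (Nat.card G : ℂ)⁻¹ * ∑ g : G, theta φ h g * χ g := rfl

/-- The map attached to a biset `U` sends the character of a representation `V` to the character
of `ℂ U ⊗_{ℂ G} V`. -/
theorem charMap_character {H G : FiniteGrp.{0}} (U : Biset H G) {V : Type} [AddCommGroup V]
    [Module ℂ V] [Module.Finite ℂ V] (ρ : Representation ℂ G V) :
    charMap (Burn.of U) ρ.character = (U.tensorRep ρ).character := by
  ext h
  simp only [U.character_tensorRep, charMap_apply, theta_of]
  rfl

theorem charMap_mem {H G : FiniteGrp.{0}} (φ : Burn H G) {χ : G → ℂ} (hχ : χ ∈ charGroup G) :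
    charMap φ χ ∈ charGroup H := by
  induction φ using Burn.ind with
  | h0 => simp
  | hn x hx => simpa using neg_mem hx
  | ha x y hx hy => simpa using add_mem hx hy
  | ho U =>
    refine charGroup_le (charMap (Burn.of U)) (charGroup H) (fun V _ _ _ ρ => ?_) hχ
    rw [charMap_character]
    exact char_mem _

theorem charMap_comp {K H G : FiniteGrp.{0}} (ψ : Burn K H) (φ : Burn H G) (χ : G → ℂ) :
    charMap (Burn.comp ψ φ) χ = charMap ψ (charMap φ χ) := by
  ext k
  simp only [charMap_apply, theta_comp, Finset.mul_sum, Finset.sum_mul]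
  rw [Finset.sum_comm]
  exact Finset.sum_congr rfl fun h _ => Finset.sum_congr rfl fun g _ => by ring

theorem charMap_iso {H G : FiniteGrp.{0}} (e : G ≃* H) {χ : G → ℂ} (hχ : χ ∈ charGroup G) (h : H) :
    charMap (Burn.iso e) χ h = χ (e.symm h) := by
  classical
  have hH : (Nat.card H : ℂ) ≠ 0 := Nat.cast_ne_zero.2 Nat.card_pos.ne'
  have h1 : ∀ g : G, theta (Burn.iso e) h g = ∑ x : H, if g = e.symm (x⁻¹ * h * x) then 1 else 0 := by
    intro g
    rw [Burn.iso, theta_of, Biset.fix]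
    have : Nat.card {x : (Biset.ofIso e).carrier // (Biset.ofIso e).l h x = (Biset.ofIso e).r x g} =
        Nat.card {x : H // g = e.symm (x⁻¹ * h * x)} :=
      Nat.card_congr (Equiv.subtypeEquivRight fun (x : H) => by
        change h * x = x * e g ↔ _
        rw [← e.injective.eq_iff, MulEquiv.apply_symm_apply, mul_assoc, eq_inv_mul_iff_mul_eq,
          eq_comm])
    rw [this, Nat.card_eq_fintype_card, Fintype.card_subtype, Finset.sum_boole]
  have h2 : ∀ x : H, χ (e.symm (x⁻¹ * h * x)) = χ (e.symm h) := by
    intro x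
    rw [mul_assoc, map_mul, charGroup_conj hχ, ← map_mul, mul_assoc, mul_inv_cancel, mul_one]
  rw [charMap_apply, Finset.sum_congr rfl fun g _ => by rw [h1 g, Finset.sum_mul], Finset.sum_comm]
  simp only [ite_mul, one_mul, zero_mul, Finset.sum_ite_eq', Finset.mem_univ, if_true, h2,
    Finset.sum_const, Finset.card_univ, nsmul_eq_mul, ← Nat.card_eq_fintype_card]
  rw [Nat.card_congr e.toEquiv, inv_mul_cancel_left₀ hH]

/-- The external product of two functions, as a function on the direct product. -/
def charMul {G H : FiniteGrp.{0}} : (G → ℂ) →+ (H → ℂ) →+ (gprod G H → ℂ) :=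
  AddMonoidHom.mk' (fun χ => AddMonoidHom.mk' (fun ρ x => χ x.1 * ρ x.2)
      (fun _ _ => by ext; simp [mul_add]))
    (fun _ _ => by ext; simp [add_mul])

theorem charMul_apply {G H : FiniteGrp.{0}} (χ : G → ℂ) (ρ : H → ℂ) (x : gprod G H) :
    charMul χ ρ x = χ x.1 * ρ x.2 := rfl

/-- The external product of two characters is the character of the external tensor product. -/
theorem charMul_character {G H : FiniteGrp.{0}} {V W : Type} [AddCommGroup V]
    [Module ℂ V] [Module.Finite ℂ V] [AddCommGroup W] [Module ℂ W] [Module.Finite ℂ W]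
    (ρ : Representation ℂ G V) (σ : Representation ℂ H W) :
    charMul ρ.character σ.character = (Representation.tprod
      (ρ.comp (MonoidHom.fst G H)) (σ.comp (MonoidHom.snd G H))).character := by
  rw [Representation.char_tensor]
  rfl

theorem charMul_mem {G H : FiniteGrp.{0}} {χ : G → ℂ} {ρ : H → ℂ} (hχ : χ ∈ charGroup G)
    (hρ : ρ ∈ charGroup H) : charMul χ ρ ∈ charGroup (gprod G H) := by
  refine charGroup_le (charMul.flip ρ) (charGroup (gprod G H)) (fun V _ _ _ σ => ?_) hχ
  refine charGroup_le (charMul σ.character) (charGroup (gprod G H)) (fun W _ _ _ τ => ?_) hρ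
  rw [charMul_character]
  exact char_mem (G := gprod G H) _

theorem charMap_charMul {G G' H H' : FiniteGrp.{0}} (φ : Burn G' G) (ψ : Burn H' H) (χ : G → ℂ)
    (ρ : H → ℂ) : charMap (Burn.prod φ ψ) (charMul χ ρ) = charMul (charMap φ χ) (charMap ψ ρ) := by
  ext x
  have hc : (Nat.card (gprod G H) : ℂ) = Nat.card G * Nat.card H := by
    rw [← Nat.cast_mul, ← Nat.card_prod]; rfl
  rw [charMul_apply, charMap_apply, charMap_apply, charMap_apply, sum_gprod, hc, mul_inv,
    mul_mul_mul_comm, Finset.sum_mul_sum]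
  congr 1
  refine Finset.sum_congr rfl fun g _ => Finset.sum_congr rfl fun h _ => ?_
  exact (congrArg₂ (· * ·) (theta_prod φ ψ x (show gprod G H from (g, h))) rfl).trans
    (mul_mul_mul_comm _ _ _ _)

theorem triv_character {g : triv} : (Representation.trivial ℂ triv ℂ).character g = 1 := by
  simp [Representation.character]

/-- The Green biset functor `R_ℂ` of complex characters over `ℤ`. -/
def RC : GreenFunctor.{0} where
  obj G := charGroup G
  map {H G} := AddMonoidHom.mk' (fun φ => AddMonoidHom.mk'
      (fun χ : charGroup G => (⟨charMap φ χ.1, charMap_mem φ χ.2⟩ : charGroup H))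
      (fun _ _ => Subtype.ext (by simp)))
    (fun _ _ => by ext; simp)
  map_id G χ := Subtype.ext (funext fun g => charMap_iso (MulEquiv.refl G) χ.2 g)
  map_comp ψ φ χ := Subtype.ext (charMap_comp ψ φ χ.1)
  mul {G H} := AddMonoidHom.mk' (fun χ : charGroup G => AddMonoidHom.mk'
      (fun ρ : charGroup H => (⟨charMul χ.1 ρ.1, charMul_mem χ.2 ρ.2⟩ : charGroup (gprod G H)))
      (fun _ _ => Subtype.ext (by simp)))
    (fun _ _ => by ext; simp)
  one := ⟨(Representation.trivial ℂ triv ℂ).character, char_mem _⟩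
  mul_map φ ψ a b := Subtype.ext (charMap_charMul φ ψ a.1 b.1)
  mul_assoc {G H K} a b c := Subtype.ext (funext fun x => by
    refine (charMap_iso (gassoc G H K) (charMul_mem (charMul_mem a.2 b.2) c.2) x).trans ?_
    exact mul_assoc _ _ _)
  one_mul {G} a := Subtype.ext (funext fun x => by
    refine (charMap_iso (gleft G) (charMul_mem (char_mem _) a.2) x).trans ?_
    exact (congrArg₂ (· * ·) triv_character (Eq.refl (a.1 x))).trans (one_mul _))
  mul_one {G} a := Subtype.ext (funext fun x => by
    refine (charMap_iso (gright G) (charMul_mem a.2 (char_mem _)) x).trans ?_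
    exact (congrArg₂ (· * ·) (Eq.refl (a.1 x)) triv_character).trans (mul_one _))

/-! #### Galois twists of characters -/

theorem exists_aut_extend {K : Type} [Field K] (i : K →+* ℂ) (τ : K ≃+* K) :
    ∃ σ : ℂ ≃+* ℂ, ∀ x, σ (i x) = i (τ x) := by
  let _ : Algebra K ℂ := i.toAlgebra
  obtain ⟨s, hs⟩ := exists_isTranscendenceBasis K ℂ
  have := IsAlgClosed.isAlgClosure_of_transcendence_basis _ hs
  let e : Algebra.adjoin K (Set.range ((↑) : s → ℂ)) ≃+* Algebra.adjoin K (Set.range ((↑) : s → ℂ)) :=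
    (hs.1.aevalEquiv.symm.toRingEquiv.trans (MvPolynomial.mapEquiv s τ)).trans
      hs.1.aevalEquiv.toRingEquiv
  refine ⟨IsAlgClosure.equivOfEquiv ℂ ℂ e, fun x => ?_⟩
  have h1 : ∀ x : K, i x = algebraMap (Algebra.adjoin K (Set.range ((↑) : s → ℂ))) ℂ
      (algebraMap K _ x) := fun x => rfl
  rw [h1, h1, IsAlgClosure.equivOfEquiv_algebraMap]
  congr 1
  change hs.1.aevalEquiv (MvPolynomial.mapEquiv s τ (hs.1.aevalEquiv.symm (algebraMap K _ x))) = _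
  rw [AlgEquiv.commutes, MvPolynomial.algebraMap_eq, MvPolynomial.mapEquiv_apply,
    MvPolynomial.map_C, ← MvPolynomial.algebraMap_eq, AlgEquiv.commutes]
  rfl

/-- For `k` prime to `n`, there is an automorphism of `ℂ` raising the `n`-th roots of unity to the
power `k`. -/
theorem exists_aut (n : ℕ) [NeZero n] (k : ℕ) (hk : k.Coprime n) :
    ∃ σ : ℂ ≃+* ℂ, ∀ z : ℂ, z ^ n = 1 → σ z = z ^ k := by
  have hK : NeZero ((n : ℕ) : ℚ) := ⟨Nat.cast_ne_zero.2 (NeZero.ne n)⟩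
  let K := CyclotomicField n ℚ
  have : IsCyclotomicExtension {n} ℚ K := CyclotomicField.isCyclotomicExtension n ℚ
  let i : K →+* ℂ := (IsAlgClosed.lift (R := ℚ) (S := K) (M := ℂ)).toRingHom
  have hζ : IsPrimitiveRoot (IsCyclotomicExtension.zeta n ℚ K) n :=
    IsCyclotomicExtension.zeta_spec n ℚ K
  have hμ := hζ.pow_of_coprime k hk
  have hirr : Irreducible (Polynomial.cyclotomic n ℚ) :=
    Polynomial.cyclotomic.irreducible_rat (NeZero.pos n)
  obtain ⟨σ, hσ⟩ := exists_aut_extend i (IsCyclotomicExtension.fromZetaAut hμ hirr).toRingEquiv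
  refine ⟨σ, fun z hz => ?_⟩
  have hiζ : IsPrimitiveRoot (i (IsCyclotomicExtension.zeta n ℚ K)) n :=
    hζ.map_of_injective i.injective
  obtain ⟨j, -, rfl⟩ := hiζ.eq_pow_of_pow_eq_one hz
  have h2 : IsCyclotomicExtension.fromZetaAut hμ hirr (IsCyclotomicExtension.zeta n ℚ K) =
    IsCyclotomicExtension.zeta n ℚ K ^ k := IsCyclotomicExtension.fromZetaAut_spec hμ hirr
  rw [map_pow, hσ]
  change i (IsCyclotomicExtension.fromZetaAut hμ hirr (IsCyclotomicExtension.zeta n ℚ K)) ^ j = _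
  rw [h2, map_pow, ← pow_mul, ← pow_mul, mul_comm]

theorem trace_pow_aut {V : Type} [AddCommGroup V] [Module ℂ V] [Module.Finite ℂ V]
    (f : Module.End ℂ V) (n k : ℕ) (hn : n ≠ 0) (hf : f ^ n = 1) (σ : ℂ ≃+* ℂ)
    (hσ : ∀ z : ℂ, z ^ n = 1 → σ z = z ^ k) :
    LinearMap.trace ℂ V (f ^ k) = σ (LinearMap.trace ℂ V f) := by
  classical
  have hss : f.IsSemisimple := by
    refine Module.End.isSemisimple_of_squarefree_aeval_eq_zero
      (p := (Polynomial.X ^ n - 1 : Polynomial ℂ)) ?_ (by simp [hf])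
    have : (Polynomial.X ^ n - Polynomial.C (1 : ℂ)).Separable :=
      Polynomial.separable_X_pow_sub_C _ (Nat.cast_ne_zero.2 hn) one_ne_zero
    simpa using this.squarefree
  have htop := hss.iSup_eigenspace_eq_top
  have hind := Module.End.eigenspaces_iSupIndep f
  have hint := DirectSum.isInternal_submodule_of_iSupIndep_of_iSup_eq_top hind htop
  have hfin := WellFoundedGT.finite_ne_bot_of_iSupIndep hind
  have hroot : ∀ μ : ℂ, f.eigenspace μ ≠ ⊥ → μ ^ n = 1 := by
    intro μ hμ
    obtain ⟨v, hv, hv0⟩ := Submodule.exists_mem_ne_zero_of_ne_bot hμ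
    have h1 : (f ^ n) v = μ ^ n • v := by
      have : ∀ m : ℕ, (f ^ m) v = μ ^ m • v := by
        intro m
        induction m with
        | zero => simp
        | succ m ih => rw [pow_succ', Module.End.mul_apply, ih, map_smul,
            Module.End.mem_eigenspace_iff.1 hv, smul_smul, pow_succ]
      exact this n
    rw [hf, Module.End.one_apply] at h1
    have : (μ ^ n - 1) • v = 0 := by rw [sub_smul, one_smul, ← h1, sub_self]
    rcases smul_eq_zero.1 this with h | h
    · exact sub_eq_zero.1 h
    · exact absurd h hv0
  have key : ∀ m : ℕ, LinearMap.trace ℂ V (f ^ m) =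
      ∑ μ ∈ hfin.toFinset, μ ^ m * (Module.finrank ℂ (f.eigenspace μ) : ℂ) := by
    intro m
    have hpow : ∀ μ, ∀ v ∈ f.eigenspace μ, (f ^ m) v = μ ^ m • v := by
      intro μ v hv
      induction m with
      | zero => simp
      | succ m ih => rw [pow_succ', Module.End.mul_apply, ih, map_smul,
          Module.End.mem_eigenspace_iff.1 hv, smul_smul, pow_succ]
    have hmaps : ∀ μ, Set.MapsTo (f ^ m) (f.eigenspace μ) (f.eigenspace μ) := fun μ v hv => by
      rw [hpow μ v hv]
      exact Submodule.smul_mem _ _ hv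
    rw [LinearMap.trace_eq_sum_trace_restrict' hint hfin hmaps]
    refine Finset.sum_congr rfl fun μ _ => ?_
    have : (f ^ m).restrict (hmaps μ) = μ ^ m • LinearMap.id := by
      ext v
      exact hpow μ v v.2
    rw [this, map_smul, LinearMap.trace_id, smul_eq_mul]
  have h1 := key 1
  rw [pow_one] at h1
  rw [key k, h1, map_sum]
  refine Finset.sum_congr rfl fun μ hμ => ?_
  rw [map_mul, map_natCast, pow_one, hσ μ (hroot μ (by simpa using hμ))]

/-- The twist of a representation by an automorphism of `ℂ`, in a basis. -/
theorem exists_twist {G : FiniteGrp.{0}} {V : Type} [AddCommGroup V] [Module ℂ V]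
    [Module.Finite ℂ V] (ρ : Representation ℂ G V) (σ : ℂ ≃+* ℂ) :
    (fun g => σ (ρ.character g)) ∈ charGroup G := by
  let b := Module.finBasis ℂ V
  let r : G →* Matrix (Fin (Module.finrank ℂ V)) (Fin (Module.finrank ℂ V)) ℂ :=
    ((RingHom.mapMatrix (σ : ℂ →+* ℂ)).toMonoidHom.comp
      (LinearMap.toMatrixAlgEquiv b : _ →* _)).comp ρ
  let ρ' : Representation ℂ G (Fin (Module.finrank ℂ V) → ℂ) :=
    (Matrix.toLinAlgEquiv' : Matrix _ _ ℂ ≃ₐ[ℂ] _).toAlgHom.toRingHom.toMonoidHom.comp r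
  have : (fun g => σ (ρ.character g)) = ρ'.character := by
    ext g
    change σ (LinearMap.trace ℂ V (ρ g)) = LinearMap.trace ℂ _ (Matrix.toLin' (r g))
    rw [Matrix.trace_toLin'_eq, LinearMap.trace_eq_matrix_trace ℂ b, Matrix.trace, map_sum]
    rfl
  rw [this]
  exact char_mem _

theorem charGroup_pow {G : FiniteGrp.{0}} {χ : G → ℂ} (hχ : χ ∈ charGroup G) (k : ℕ)
    (hk : k.Coprime (Nat.card G)) : (fun g => χ (g ^ k)) ∈ charGroup G := by
  refine charGroup_le (X := G → ℂ) (AddMonoidHom.mk' (fun χ g => χ (g ^ k)) fun _ _ => rfl)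
    (charGroup G) (fun V _ _ _ ρ => ?_) hχ
  have : NeZero (Nat.card G) := ⟨Nat.card_pos.ne'⟩
  obtain ⟨σ, hσ⟩ := exists_aut (Nat.card G) k hk
  have h : (fun g : G => ρ.character (g ^ k)) = fun g => σ (ρ.character g) := by
    ext g
    change LinearMap.trace ℂ V (ρ (g ^ k)) = σ (LinearMap.trace ℂ V (ρ g))
    rw [map_pow]
    exact trace_pow_aut (ρ g) (Nat.card G) k (NeZero.ne _)
      (by rw [← map_pow, pow_card_eq_one', map_one]) σ hσ
  change (fun g : G => ρ.character (g ^ k)) ∈ _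
  rw [h]
  exact exists_twist ρ σ

theorem pow_modEq {T : Type*} [Group T] {m k l : ℕ} (hkl : k ≡ l [MOD m]) (t : T) (ht : t ^ m = 1) :
    t ^ k = t ^ l := by
  rw [pow_eq_pow_iff_modEq]
  exact hkl.of_dvd (orderOf_dvd_of_pow_eq_one ht)

theorem Biset.fix_le_pow {H G : FiniteGrp.{0}} (U : Biset H G) (h : H) (g : G) (k : ℕ)
    (x : U.carrier) (hx : U.l h x = U.r x g) : U.l (h ^ k) x = U.r x (g ^ k) := by
  induction k with
  | zero => rw [pow_zero, pow_zero, U.one_l, U.r_one]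
  | succ k ih => rw [pow_succ, U.mul_l, hx, U.l_r, ih, ← U.r_mul, ← pow_succ]

theorem theta_pow {H G : FiniteGrp.{0}} (φ : Burn H G) (h : H) (g : G) (k : ℕ)
    (hk : k.Coprime (Nat.card H * Nat.card G)) : theta φ (h ^ k) (g ^ k) = theta φ h g := by
  have : NeZero (Nat.card H * Nat.card G) := ⟨(Nat.mul_pos Nat.card_pos Nat.card_pos).ne'⟩
  obtain ⟨l, hl⟩ : ∃ l : ℕ, k * l ≡ 1 [MOD Nat.card H * Nat.card G] := by
    refine ⟨((k : ZMod (Nat.card H * Nat.card G))⁻¹).val, ?_⟩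
    rw [← ZMod.natCast_eq_natCast_iff, Nat.cast_mul, ZMod.natCast_zmod_val, Nat.cast_one,
      ZMod.coe_mul_inv_eq_one k hk]
  have hinv : ∀ (T : FiniteGrp.{0}), Nat.card T ∣ Nat.card H * Nat.card G → ∀ t : T,
      (t ^ k) ^ l = t := by
    intro T hT t
    rw [← pow_mul, pow_modEq (hl.of_dvd hT) t pow_card_eq_one', pow_one]
  induction φ using Burn.ind with
  | h0 => simp
  | hn x hx => simpa using hx
  | ha x y hx hy => simp [hx, hy]
  | ho U =>
    rw [theta_of, theta_of, Biset.fix, Biset.fix]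
    congr 1
    refine Nat.card_congr (Equiv.subtypeEquivRight fun x => ⟨fun hx => ?_, U.fix_le_pow h g k x⟩)
    have := U.fix_le_pow _ _ l x hx
    rwa [hinv H (Dvd.intro _ rfl), hinv G (Dvd.intro_left _ rfl)] at this

theorem charMap_pow {H G : FiniteGrp.{0}} (φ : Burn H G) (χ : G → ℂ) (k : ℕ)
    (hk : k.Coprime (Nat.card H * Nat.card G)) (h : H) :
    charMap φ (fun g => χ (g ^ k)) h = charMap φ χ (h ^ k) := by
  rw [charMap_apply, charMap_apply]
  congr 1
  refine Fintype.sum_equiv (powCoprime (Nat.Coprime.coprime_mul_left_right hk).symm) _ _ fun g => ?_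
  rw [powCoprime_apply, theta_pow φ h g k hk]

/-! ### The group `ẑ^×` and its action on characters -/

/-- The group of units of the profinite completion of `ℤ`: the inverse limit of the groups
`(ℤ/n)^×`, for `n ≥ 1` ordered by divisibility. -/
def ZHatUnits : Subgroup (∀ n : ℕ+, (ZMod n)ˣ) where
  carrier := {s | ∀ (m n : ℕ+) (h : (m : ℕ) ∣ n), ZMod.unitsMap h (s n) = s m}
  one_mem' := fun m n h => by simp
  mul_mem' := fun {s t} hs ht m n h => by simp [hs m n h, ht m n h]
  inv_mem' := fun {s} hs m n h => by simp [hs m n h]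

/-- The projection `π_n` to `(ℤ/n)^×`. -/
def zproj (n : ℕ+) : ZHatUnits →* (ZMod n)ˣ :=
  (Pi.evalMonoidHom _ n).comp ZHatUnits.subtype

/-- A natural number representing `π_n(s)`. -/
def zrep (s : ZHatUnits) (n : ℕ+) : ℕ := (zproj n s : ZMod n).val

theorem zrep_coprime (s : ZHatUnits) (n : ℕ+) : (zrep s n).Coprime n :=
  ZMod.val_coe_unit_coprime _

theorem zrep_modEq (s : ZHatUnits) {m n : ℕ+} (h : (m : ℕ) ∣ n) :
    zrep s n ≡ zrep s m [MOD m] := by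
  rw [← ZMod.natCast_eq_natCast_iff, zrep, zrep, ZMod.natCast_val, ZMod.natCast_zmod_val]
  exact congrArg Units.val (s.2 m n h)

/-- For `g` with `g ^ n = 1`, the power `g ^ π_n(s)` does not depend on `n`. -/
theorem pow_zrep (s : ZHatUnits) {T : Type*} [Group T] (t : T) (m n : ℕ+)
    (hm : t ^ (m : ℕ) = 1) (hn : t ^ (n : ℕ) = 1) : t ^ zrep s m = t ^ zrep s n := by
  rw [← pow_modEq (zrep_modEq s (m := m) (n := m * n) (Dvd.intro _ rfl)) t hm,
    ← pow_modEq (zrep_modEq s (m := n) (n := m * n) (Dvd.intro_left _ rfl)) t hn]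

/-- The order of a finite group. -/
def gcard (G : FiniteGrp.{0}) : ℕ+ := ⟨Nat.card G, Nat.card_pos⟩

theorem pow_gcard {G : FiniteGrp.{0}} (g : G) : g ^ (gcard G : ℕ) = 1 := pow_card_eq_one'

/-- The action of `ẑ^×` on characters: `s(χ)(g) = χ(g ^ π_n(s))`, where `n` is the order of `G`
(or any other multiple of the exponent of `G`, see `galois_apply`). -/
def galois (s : ZHatUnits) {G : FiniteGrp.{0}} : RC.obj G →+ RC.obj G :=
  AddMonoidHom.mk' (fun χ : charGroup G =>
      (⟨fun g => χ.1 (g ^ zrep s (gcard G)), charGroup_pow χ.2 _ (zrep_coprime s (gcard G))⟩ :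
        charGroup G))
    (fun _ _ => rfl)

theorem galois_apply (s : ZHatUnits) {G : FiniteGrp.{0}} (χ : RC.obj G) (n : ℕ+)
    (hn : Monoid.exponent G ∣ n) (g : G) : (galois s χ).1 g = χ.1 (g ^ zrep s n) :=
  congrArg χ.1 (pow_zrep s g _ _ (pow_gcard g) (Monoid.exponent_dvd_iff_forall_pow_eq_one.1 hn g))

theorem galois_of_pow (s : ZHatUnits) {G : FiniteGrp.{0}} (χ : RC.obj G) (n : ℕ+) (g : G)
    (hn : g ^ (n : ℕ) = 1) : (galois s χ).1 g = χ.1 (g ^ zrep s n) :=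
  congrArg χ.1 (pow_zrep s g _ _ (pow_gcard g) hn)

theorem galois_mul (s : ZHatUnits) {G H : FiniteGrp.{0}} (χ : RC.obj G) (ρ : RC.obj H) :
    galois s (RC.mul χ ρ) = RC.mul (galois s χ) (galois s ρ) := by
  refine Subtype.ext (funext fun x : gprod G H => ?_)
  have h1 : x.1 ^ (gcard (gprod G H) : ℕ) = 1 := congrArg Prod.fst (pow_gcard x)
  have h2 : x.2 ^ (gcard (gprod G H) : ℕ) = 1 := congrArg Prod.snd (pow_gcard x)
  exact (congrArg₂ (· * ·) (galois_of_pow s χ _ _ h1) (galois_of_pow s ρ _ _ h2)).symm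

theorem galois_map (s : ZHatUnits) {H G : FiniteGrp.{0}} (φ : Burn H G) (χ : RC.obj G) :
    galois s (RC.map φ χ) = RC.map φ (galois s χ) := by
  refine Subtype.ext (funext fun h : H => ?_)
  have hg : ∀ g : G, g ^ (gcard H * gcard G : ℕ) = 1 := fun g => by
    rw [pow_mul', pow_gcard, one_pow]
  have hh : h ^ (gcard H * gcard G : ℕ) = 1 := by
    rw [pow_mul, pow_gcard, one_pow]
  rw [galois_of_pow s _ (gcard H * gcard G) h hh]
  have h2 : (galois s χ).1 = fun g => χ.1 (g ^ zrep s (gcard H * gcard G)) :=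
    funext fun g => galois_of_pow s χ (gcard H * gcard G) g (hg g)
  change charMap φ χ.1 (h ^ _) = charMap φ (galois s χ).1 h
  rw [h2]
  exact (charMap_pow φ χ.1 _ (zrep_coprime s (gcard H * gcard G)) h).symm

theorem galois_one {G : FiniteGrp.{0}} (χ : RC.obj G) : galois 1 χ = χ := by
  refine Subtype.ext (funext fun g : G => ?_)
  refine congrArg χ.1 ((pow_modEq (l := 1) ?_ g (pow_gcard g)).trans (pow_one g))
  rw [← ZMod.natCast_eq_natCast_iff, zrep, ZMod.natCast_zmod_val, map_one, Units.val_one,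
    Nat.cast_one]

theorem galois_unit (s : ZHatUnits) : galois s RC.one = RC.one := by
  refine Subtype.ext (funext fun g : triv => ?_)
  exact (triv_character (g := g ^ _)).trans (triv_character (g := g)).symm

theorem galois_congr {s t : ZHatUnits} {G : FiniteGrp.{0}} (h : zproj (gcard G) s = zproj (gcard G) t)
    (χ : RC.obj G) : galois s χ = galois t χ := by
  refine Subtype.ext (funext fun g : G => ?_)
  change χ.1 (g ^ zrep s (gcard G)) = χ.1 (g ^ zrep t (gcard G))
  rw [zrep, zrep, h]

/-! ### The bimodule of locally constant maps -/

theorem zproj_of_dvd {s t : ZHatUnits} {m n : ℕ+} (h : (m : ℕ) ∣ n) (hst : zproj n s = zproj n t) :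
    zproj m s = zproj m t := by
  refine (s.2 m n h).symm.trans (Eq.trans ?_ (t.2 m n h))
  exact congrArg _ hst

theorem exists_factor {X : Type*} [Nonempty X] (f : ZHatUnits → X) (n : ℕ+)
    (hf : ∀ s t, zproj n s = zproj n t → f s = f t) :
    ∃ fbar : (ZMod n)ˣ → X, ∀ s, f s = fbar (zproj n s) := by
  exact ⟨Function.extend (zproj n) f fun _ => Classical.arbitrary X, fun s =>
    (Function.FactorsThrough.extend_apply (fun s t h => hf s t h) _ s).symm⟩

/-- The group `Loc(G)` of locally constant maps from `ẑ^×` to `R_ℂ(G)`: the maps that factor through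
the projection `π_n`, for some `n`. -/
def locSub (G : FiniteGrp.{0}) : AddSubgroup (ZHatUnits → RC.obj G) where
  carrier := {f | ∃ (n : ℕ+) (fbar : (ZMod n)ˣ → RC.obj G), ∀ s, f s = fbar (zproj n s)}
  zero_mem' := ⟨1, 0, fun _ => rfl⟩
  add_mem' := by
    rintro f f' ⟨n, k, hk⟩ ⟨n', k', hk'⟩
    refine ⟨n * n', exists_factor _ _ fun s t h => ?_⟩
    rw [Pi.add_apply, Pi.add_apply, hk, hk, hk', hk', zproj_of_dvd (Dvd.intro _ rfl) h,
      zproj_of_dvd (Dvd.intro_left _ rfl) h]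
  neg_mem' := by
    rintro f ⟨n, k, hk⟩
    exact ⟨n, -k, fun s => by rw [Pi.neg_apply, hk, Pi.neg_apply]⟩

theorem locSub_map {G H : FiniteGrp.{0}} (F : ZHatUnits → RC.obj G → RC.obj H) (n : ℕ+)
    (hF : ∀ s t, zproj n s = zproj n t → F s = F t) {f : ZHatUnits → RC.obj G}
    (hf : f ∈ locSub G) : (fun s => F s (f s)) ∈ locSub H := by
  obtain ⟨m, k, hk⟩ := hf
  refine ⟨n * m, exists_factor _ _ fun s t h => ?_⟩
  rw [hk, hk, hF s t (zproj_of_dvd (Dvd.intro _ rfl) h), zproj_of_dvd (Dvd.intro_left _ rfl) h]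

theorem locSub_lact {G H : FiniteGrp.{0}} (χ : RC.obj G) {f : ZHatUnits → RC.obj H}
    (hf : f ∈ locSub H) : (fun s => RC.mul (galois s χ) (f s)) ∈ locSub (gprod G H) :=
  locSub_map (fun s x => RC.mul (galois s χ) x) (gcard G)
    (fun s t h => by rw [galois_congr h]) hf

theorem locSub_const {G H : FiniteGrp.{0}} (F : RC.obj G →+ RC.obj H) {f : ZHatUnits → RC.obj G}
    (hf : f ∈ locSub G) : (fun s => F (f s)) ∈ locSub H :=
  locSub_map (fun _ x => F x) 1 (fun _ _ _ => rfl) hf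

/-- The bimodule `Loc` of locally constant maps, with the biset operations of `R_ℂ` applied
pointwise, and with the actions `(χ × f × ρ)(s) = s(χ) × f(s) × ρ`. -/
def Loc : Bimodule.{0, 0} RC where
  obj G := locSub G
  map {H G} := AddMonoidHom.mk' (fun φ => AddMonoidHom.mk'
      (fun f : locSub G => (⟨fun s => RC.map φ (f.1 s), locSub_const (RC.map φ) f.2⟩ : locSub H))
      (fun _ _ => Subtype.ext (funext fun _ => map_add _ _ _)))
    (fun φ ψ => AddMonoidHom.ext fun f => Subtype.ext (funext fun s =>
      DFunLike.congr_fun (map_add RC.map φ ψ) (f.1 s)))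
  lact {G H} := AddMonoidHom.mk' (fun χ => AddMonoidHom.mk'
      (fun f : locSub H => (⟨fun s => RC.mul (galois s χ) (f.1 s), locSub_lact χ f.2⟩ :
        locSub (gprod G H)))
      (fun _ _ => Subtype.ext (funext fun _ => map_add _ _ _)))
    (fun χ χ' => AddMonoidHom.ext fun f => Subtype.ext (funext fun s => by
      change RC.mul (galois s (χ + χ')) (f.1 s) = RC.mul (galois s χ) (f.1 s) +
        RC.mul (galois s χ') (f.1 s)
      rw [map_add, map_add, AddMonoidHom.add_apply]))
  ract {G H} := AddMonoidHom.mk' (fun f : locSub G => AddMonoidHom.mk'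
      (fun ρ => (⟨fun s => RC.mul (f.1 s) ρ, locSub_const (RC.mul.flip ρ) f.2⟩ :
        locSub (gprod G H)))
      (fun _ _ => Subtype.ext (funext fun _ => map_add _ _ _)))
    (fun f f' => AddMonoidHom.ext fun ρ => Subtype.ext (funext fun s =>
      DFunLike.congr_fun (map_add RC.mul (f.1 s) (f'.1 s)) ρ))
  map_id G f := Subtype.ext (funext fun s => RC.map_id G (f.1 s))
  map_comp ψ φ f := Subtype.ext (funext fun s => RC.map_comp ψ φ (f.1 s))
  lact_map φ ψ χ f := Subtype.ext (funext fun s => by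
    refine (RC.mul_map φ ψ (galois s χ) (f.1 s)).trans ?_
    rw [← galois_map]
    rfl)
  ract_map φ ψ f ρ := Subtype.ext (funext fun s => RC.mul_map φ ψ (f.1 s) ρ)
  mul_lact χ χ' f := Subtype.ext (funext fun s => by
    refine Eq.trans ?_ (RC.mul_assoc (galois s χ) (galois s χ') (f.1 s))
    rw [← galois_mul]
    rfl)
  ract_mul f ρ ρ' := Subtype.ext (funext fun s => RC.mul_assoc (f.1 s) ρ ρ')
  lact_ract χ f ρ := Subtype.ext (funext fun s => RC.mul_assoc (galois s χ) (f.1 s) ρ)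
  one_lact f := Subtype.ext (funext fun s => by
    change RC.map (Burn.iso (gleft _)) (RC.mul (galois s RC.one) (f.1 s)) = f.1 s
    rw [galois_unit, RC.one_mul])
  ract_one f := Subtype.ext (funext fun s => RC.mul_one (f.1 s))

/-- The morphism of bimodules `λ : Loc → R_ℂ`, evaluation at the identity of `ẑ^×`. -/
def lam : Loc.Hom RC.regular where
  app G := AddMonoidHom.mk' (fun f : locSub G => f.1 1) (fun _ _ => rfl)
  naturality φ f := rfl
  map_lact {G H} χ f := by
    refine Eq.trans (b := RC.mul (galois 1 χ) (f.1 1)) rfl ?_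
    rw [galois_one]
    rfl
  map_ract f ρ := rfl

/-- The inclusion of a subbimodule. -/
def Bimodule.incl {A : GreenFunctor.{u}} (M : Bimodule.{u, v} A)
    (S : ∀ G : FiniteGrp.{0}, AddSubgroup (M.obj G)) (hS : M.IsSubbimodule S) :
    (M.sub S hS).Hom M where
  app G := (S G).subtype
  naturality _ _ := rfl
  map_lact _ _ := rfl
  map_ract _ _ := rfl

/-- An element of `Loc(G)`, as a map on `ẑ^×`. -/
def locFun {G : FiniteGrp.{0}} (f : Loc.obj G) : ZHatUnits → RC.obj G := Subtype.val (p := (· ∈ locSub G)) f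

end BisetHH

end

open BisetHH

noncomputable section

namespace BisetHH

universe u v w x

/-! ### Elements of `ẑ^×` close to the identity -/

/-! The left action of `RC` on `Loc` is twisted by the Galois action and the right action is not. So
an element m of `Loc` at the trivial group, i.e. a locally constant function s ↦ m(s) with values in
R_ℂ(1), satisfies χ × m = m × χ for all χ exactly when s(χ) m(s) = χ m(s) for all s and χ. Such an m
vanishes at s = 1. Indeed m(s) depends only on s modulo some n, and arbitrarily close to 1 there are
elements s ≠ 1 that move some character: m(s) = 0 for such an s, and m(s) = m(1) once s ≡ 1 mod n.
This is `eq_zero_of_intertwines`, and every negative statement reduces to it.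

The required s are explicit (`signAway`): s equals 1 at the primes dividing n and -1 at the others.
Then s ≡ 1 mod n, while s ≡ -1 modulo the odd number N = 2n + 1, which is coprime to n. Hence s
sends a faithful linear character of the cyclic group of order N to its complex conjugate, which is
different (`exists_galois_ne`).

No section of λ (`lam_not_split`): a bimodule section would send the identity ε to an m commuting
with all characters, because ε does; but then m(1) = 0, whereas λ(m) = ε. As λ is surjective, `RC`
is not projective. Moreover μ factors as λ composed with the bimodule morphism a ⊗ b ↦ (s ↦ s(a) ×
b), so a section of μ would give one of λ, and `RC` is not separable.

The derivation: d(χ)(s) = s(χ) - χ is the difference of the orbit map χ ↦ (s ↦ s(χ)) and the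
constant map. In `Loc` it is the inner derivation of the constant map ε, which does not lie in the
kernel L of λ. If d were inner in L, given by m with m(1) = 0, then 1 - m(s) would satisfy the
intertwining relation and would vanish at s = 1, giving 1 = 0 (`galoisDer_not_inner`). The class of
d in the cohomology at the trivial group is non-zero once M is compared with M(- × 1)
(`HH1_triv_nontrivial`). -/

/-- The powers of `a` are eventually periodic, with preperiod and period at most the order of `R`.
The factorial of `k` is a multiple of the period lying beyond the preperiod, so doubling this
exponent changes nothing. Using a factorial gives one exponent that works for every element at once.
-/
theorem pow_factorial_isIdempotentElem {R : Type*} [Monoid R] [Finite R] (a : R) (k : ℕ)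
    (hk : Nat.card R ≤ k) : IsIdempotentElem (a ^ k.factorial) := by
  -- Pigeonhole on the exponents from 0 to the order of `R`.
  obtain ⟨i, j, hij, h⟩ : ∃ i j : Fin (Nat.card R + 1), i < j ∧ a ^ (i : ℕ) = a ^ (j : ℕ) := by
    have := Fintype.ofFinite R
    obtain ⟨i, j, hne, h⟩ := Fintype.exists_ne_map_eq_of_card_lt
      (fun i : Fin (Nat.card R + 1) => a ^ (i : ℕ)) (by simp [Nat.card_eq_fintype_card])
    rcases lt_or_gt_of_ne hne with h' | h'
    exacts [⟨i, j, h', h⟩, ⟨j, i, h', h.symm⟩]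
  have hj := j.2
  have hij' : (i : ℕ) < j := hij
  obtain ⟨p, hp⟩ := Nat.exists_eq_add_of_lt hij'
  -- The period is j - i = p + 1, valid from exponent i on.
  have hper : ∀ t l : ℕ, (i : ℕ) ≤ l → a ^ (l + t * (p + 1)) = a ^ l := by
    intro t l hl
    induction t with
    | zero => simp
    | succ t ih =>
      obtain ⟨r, rfl⟩ := Nat.exists_eq_add_of_le hl
      rw [← ih, show (i : ℕ) + r + (t + 1) * (p + 1) = j + (r + t * (p + 1)) by rw [hp]; ring,
        pow_add, ← h, ← pow_add, add_assoc]
  -- The period satisfies p + 1 ≤ j ≤ |R| ≤ k.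
  obtain ⟨t, ht⟩ : p + 1 ∣ k.factorial := Nat.dvd_factorial (Nat.succ_pos _) (by omega)
  have hle : (i : ℕ) ≤ k.factorial := le_trans (by omega) (Nat.self_le_factorial k)
  have := hper t _ hle
  rw [mul_comm, ← ht, pow_add] at this
  exact this

theorem IsIdempotentElem.pow_of_ne_zero {R : Type*} [Monoid R] {e : R} (he : IsIdempotentElem e) {k : ℕ}
    (hk : k ≠ 0) : e ^ k = e := by
  obtain ⟨k, rfl⟩ := Nat.exists_eq_succ_of_ne_zero hk
  exact he.pow_succ_eq k

/-- The unit `1 - 2 e` attached to an idempotent `e`. -/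
def idemUnit {R : Type*} [CommRing R] (e : R) (he : IsIdempotentElem e) : Rˣ where
  val := 1 - 2 * e
  inv := 1 - 2 * e
  -- The unit is its own inverse: (1 - 2e)² = 1 - 4e + 4e² = 1.
  val_inv := by linear_combination 4 * he.eq
  inv_val := by linear_combination 4 * he.eq

/-- In the decomposition of `ZMod m` into prime-power parts, this idempotent is 0 at the primes
dividing `n` and 1 at the others. It separates these two sets of primes without any factorization of
`m`. -/
theorem natCast_pow_factorial_idem (n : ℕ) (m : ℕ+) :
    IsIdempotentElem ((n : ZMod m) ^ (m : ℕ).factorial) :=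
  pow_factorial_isIdempotentElem _ _ (by rw [Nat.card_zmod])

/-- The element of `ẑ^×` equal to `-1` at the primes that do not divide `n` and to `1` at the
primes that divide `n`. -/
def signAway (n : ℕ) : ZHatUnits :=
  ⟨fun m => idemUnit _ (natCast_pow_factorial_idem n m), by
    intro m m' h
    apply Units.ext
    have hle : (m : ℕ) ≤ m' := Nat.le_of_dvd m'.pos h
    obtain ⟨t, ht⟩ := Nat.factorial_dvd_factorial hle
    have ht0 : t ≠ 0 := by
      rintro rfl
      exact (m' : ℕ).factorial_ne_zero (by simpa using ht)
    -- Compatibility of the levels: the exponent at level m' is t times the exponent at level m,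
    -- with t ≠ 0, and an idempotent equals its t-th power.
    change ZMod.castHom h (ZMod m) (1 - 2 * (n : ZMod m') ^ (m' : ℕ).factorial) =
      1 - 2 * (n : ZMod m) ^ (m : ℕ).factorial
    rw [map_sub, map_mul, map_pow, map_natCast, map_one, map_ofNat, ht, pow_mul,
      IsIdempotentElem.pow_of_ne_zero (natCast_pow_factorial_idem n m) ht0]⟩

theorem val_zproj_signAway (n : ℕ) (m : ℕ+) :
    (zproj m (signAway n) : ZMod m) = 1 - 2 * (n : ZMod m) ^ (m : ℕ).factorial := rfl

/-- Modulo `n` the class of `n` is 0, and so is its power because a factorial is never 0; the unit 1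
- 2·0 is 1. This is the sense in which `signAway n` is close to the identity. -/
theorem zproj_signAway_self (n : ℕ+) : zproj n (signAway n) = zproj n 1 := by
  apply Units.ext
  rw [val_zproj_signAway, ZMod.natCast_self, zero_pow (Nat.factorial_ne_zero _), map_one]
  simp

theorem zproj_signAway_of_coprime (n : ℕ) (m : ℕ+) (h : n.Coprime m) :
    (zproj m (signAway n) : ZMod m) = -1 := by
  have hu : IsUnit ((n : ZMod m) ^ (m : ℕ).factorial) :=
    ((ZMod.isUnit_iff_coprime n m).2 h).pow _
  -- An invertible idempotent is 1.
  have h1 : (n : ZMod m) ^ (m : ℕ).factorial = 1 :=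
    hu.mul_left_cancel ((natCast_pow_factorial_idem n m).eq.trans (mul_one _).symm)
  rw [val_zproj_signAway, h1]
  ring

/-! ### Galois action on linear characters of cyclic groups -/

/-- Let `G` act on the line ℂ by the scalars θ(g); the trace of a scalar on a line is that scalar.
-/
theorem linear_mem_charGroup {G : FiniteGrp.{0}} (θ : G →* ℂ) : (θ : G → ℂ) ∈ charGroup G := by
  let ρ : Representation ℂ G ℂ := (algebraMap ℂ (Module.End ℂ ℂ) : ℂ →* _).comp θ
  have : ρ.character = θ := by
    ext g
    change LinearMap.trace ℂ ℂ (algebraMap ℂ (Module.End ℂ ℂ) (θ g)) = θ g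
    rw [Algebra.algebraMap_eq_smul_one, map_smul, LinearMap.trace_one]
    simp
  rw [← this]
  exact char_mem ρ

/-- There are elements of `ẑ^×` arbitrarily close to `1` which act non trivially on characters. -/
theorem exists_galois_ne (n : ℕ+) : ∃ (s : ZHatUnits) (G : FiniteGrp.{0}) (χ : RC.obj G) (g : G),
    zproj n s = zproj n 1 ∧ (galois s χ).1 g ≠ χ.1 g := by
  -- This choice makes N coprime to n, so that `signAway n` is -1 modulo N, and odd and at least 3,
  -- so that -1 ≠ 1 modulo N. The group has to depend on n, since the action on the characters of a
  -- fixed group factors through a finite level.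
  let N : ℕ+ := 2 * n + 1
  have hN : (N : ℕ) = 2 * n + 1 := rfl
  have hcop : (n : ℕ).Coprime N := by simp [hN]
  have hpos := n.pos
  let G : FiniteGrp.{0} := FiniteGrp.of (Multiplicative (ZMod N))
  let θ : G →* ℂ := (ZMod.stdAddChar (N := (N : ℕ))).toMonoidHom
  let χ : RC.obj G := (⟨θ, linear_mem_charGroup θ⟩ : charGroup G)
  let g : G := Multiplicative.ofAdd (1 : ZMod N)
  have hg : g ^ (N : ℕ) = 1 := by
    change Multiplicative.ofAdd ((N : ℕ) • (1 : ZMod N)) = Multiplicative.ofAdd 0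
    simp
  -- Written additively, the action of s replaces the generator 1 of `ZMod N` by -1.
  have hpow : g ^ zrep (signAway n) N = (Multiplicative.ofAdd (-1 : ZMod N) : G) := by
    change Multiplicative.ofAdd (zrep (signAway n) N • (1 : ZMod N)) = _
    rw [nsmul_one, zrep, ZMod.natCast_zmod_val, zproj_signAway_of_coprime _ _ hcop]
    rfl
  refine ⟨signAway n, G, χ, g, zproj_signAway_self n, fun h => ?_⟩
  rw [galois_of_pow _ χ N g hg, hpow] at h
  -- Faithfulness of the standard character turns an equality of values into an equality in `ZMod
  -- N`, which would force N to divide 2.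
  have h1 : (-1 : ZMod N) = 1 := ZMod.injective_stdAddChar h
  have h2 : ((2 : ℕ) : ZMod N) = 0 := by
    push_cast
    linear_combination -h1
  rw [ZMod.natCast_eq_zero_iff] at h2
  have := Nat.le_of_dvd two_pos h2
  omega

/-! ### The vanishing criterion for intertwining functions -/

/-- A locally constant function on `ẑ^×` that intertwines the Galois action on all characters
with the trivial action vanishes at `1`. -/
theorem eq_zero_of_intertwines (f : ZHatUnits → ℂ) (n : ℕ+)
    (hn : ∀ s t, zproj n s = zproj n t → f s = f t)
    (h : ∀ (s : ZHatUnits) (G : FiniteGrp.{0}) (χ : RC.obj G) (g : G),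
      (galois s χ).1 g * f s = χ.1 g * f s) : f 1 = 0 := by
  obtain ⟨s, G, χ, g, hs, hne⟩ := exists_galois_ne n
  -- The function cannot distinguish s from 1, so it is enough to show that it vanishes at s, where
  -- s moves a character value.
  rw [← hn s 1 hs]
  by_contra h0
  exact hne (mul_right_cancel₀ h0 (h s G χ g))

/-! ### Unit isomorphisms and the bimodule of locally constant maps -/

/-- Turns the identification of G × 1 with G into multiplication by a complex number, since an
element of R_ℂ(1) is determined by its value at the identity. With the next lemma it converts
identities between bimodule products into scalar equations. -/
theorem RC_gright_apply {G : FiniteGrp.{0}} (χ : RC.obj G) (m : RC.obj triv) (g : G) :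
    (RC.map (Burn.iso (gright G)) (RC.mul χ m)).1 g = χ.1 g * m.1 (1 : triv) :=
  charMap_iso (gright G) (charMul_mem χ.2 m.2) g

theorem RC_gleft_apply {G : FiniteGrp.{0}} (m : RC.obj triv) (χ : RC.obj G) (g : G) :
    (RC.map (Burn.iso (gleft G)) (RC.mul m χ)).1 g = m.1 (1 : triv) * χ.1 g :=
  charMap_iso (gleft G) (charMul_mem m.2 χ.2) g

/-- Restates local constancy in the form that `eq_zero_of_intertwines` takes as hypothesis. -/
theorem exists_conductor {G : FiniteGrp.{0}} (f : Loc.obj G) :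
    ∃ n : ℕ+, ∀ s t, zproj n s = zproj n t → locFun f s = locFun f t := by
  obtain ⟨n, k, hk⟩ := f.2
  exact ⟨n, fun s t h => (hk s).trans ((congrArg k h).trans (hk t).symm)⟩

/-- The order of `G` serves as conductor: s acts on characters of `G` through its class modulo |G|.
-/
theorem mem_locSub_orbit {G : FiniteGrp.{0}} (χ : RC.obj G) : (fun s => galois s χ) ∈ locSub G :=
  ⟨gcard G, exists_factor _ _ fun _ _ h => galois_congr h χ⟩

theorem mem_locSub_constant {G : FiniteGrp.{0}} (χ : RC.obj G) :
    (fun _ => χ) ∈ locSub G := ⟨1, fun _ => χ, fun _ => rfl⟩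

/-- The map `χ ↦ (s ↦ s(χ))` from `R_ℂ(G)` to `Loc(G)`. -/
def orbit (G : FiniteGrp.{0}) : RC.obj G →+ Loc.obj G :=
  AddMonoidHom.mk' (fun χ => (⟨fun s => galois s χ, mem_locSub_orbit χ⟩ : locSub G))
    (fun _ _ => Subtype.ext (funext fun _ => map_add _ _ _))

/-- The map from `R_ℂ(G)` to `Loc(G)` sending `χ` to the constant map with value `χ`. -/
def constant (G : FiniteGrp.{0}) : RC.obj G →+ Loc.obj G :=
  AddMonoidHom.mk' (fun χ => (⟨fun _ => χ, mem_locSub_constant χ⟩ : locSub G))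
    (fun _ _ => rfl)

/-! ### Linearity of the orbit map on the left and of the constant map on the right -/

theorem orbit_map {H G : FiniteGrp.{0}} (φ : Burn H G) (χ : RC.obj G) :
    orbit H (RC.map φ χ) = Loc.map φ (orbit G χ) :=
  Subtype.ext (funext fun s => galois_map s φ χ)

/-- Each s acts multiplicatively, which matches the twist in the left action of `Loc`. Hence `orbit`
is linear on the left, as `constant` is on the right; neither can be a morphism of bimodules, since
both are sections of λ. -/
theorem orbit_mul {G H : FiniteGrp.{0}} (χ : RC.obj G) (ρ : RC.obj H) :
    orbit (gprod G H) (RC.mul χ ρ) = Loc.lact χ (orbit H ρ) :=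
  Subtype.ext (funext fun s => galois_mul s χ ρ)

theorem constant_map {H G : FiniteGrp.{0}} (φ : Burn H G) (χ : RC.obj G) :
    constant H (RC.map φ χ) = Loc.map φ (constant G χ) := rfl

theorem constant_mul {G H : FiniteGrp.{0}} (χ : RC.obj G) (ρ : RC.obj H) :
    constant (gprod G H) (RC.mul χ ρ) = Loc.ract (constant G χ) ρ := rfl

/-- Both sides are s ↦ s(χ) × ρ. This common value is the cross term that cancels in the Leibniz
rule for `orbit - constant`. -/
theorem lact_constant {G H : FiniteGrp.{0}} (χ : RC.obj G) (ρ : RC.obj H) :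
    Loc.lact χ (constant H ρ) = Loc.ract (orbit G χ) ρ := rfl

theorem lam_orbit {G : FiniteGrp.{0}} (χ : RC.obj G) : lam.app G (orbit G χ) = χ := galois_one χ

theorem lam_constant {G : FiniteGrp.{0}} (χ : RC.obj G) : lam.app G (constant G χ) = χ := rfl

/-! ### The evaluation morphism does not split -/

/-- A section is governed by the image m of the identity element. Since ε commutes with every
character, so does m, and the vanishing criterion gives m(1) = 0; the section property says that
m(1) = ε. -/
theorem lam_not_split (g : RC.regular.Hom Loc)
    (hg : ∀ (G : FiniteGrp.{0}) (χ : RC.obj G), lam.app G (g.app G χ) = χ) : False := by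
  let m : Loc.obj triv := g.app triv RC.one
  obtain ⟨n, hn⟩ := exists_conductor m
  -- Both sides are the image of χ under the section, one through χ = χ × ε and the other through χ
  -- = ε × χ.
  have key : ∀ (G : FiniteGrp.{0}) (χ : RC.obj G),
      Loc.map (Burn.iso (gright G)) (Loc.lact χ m) =
        Loc.map (Burn.iso (gleft G)) (Loc.ract m χ) := by
    intro G χ
    have h1 := (congrArg (g.app G) (RC.mul_one χ)).symm.trans (g.naturality _ _)
    have h2 := (congrArg (g.app G) (RC.one_mul χ)).symm.trans (g.naturality _ _)
    have h3 := congrArg (Loc.map (Burn.iso (gright G))) (g.map_lact χ RC.one)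
    have h4 := congrArg (Loc.map (Burn.iso (gleft G))) (g.map_ract RC.one χ)
    exact h3.symm.trans (h1.symm.trans (h2.trans h4))
  -- At s and x, `key` reads s(χ)(x) m(s) = m(s) χ(x): only the left product carries the Galois
  -- twist.
  have h0 := eq_zero_of_intertwines (fun s => (locFun m s).1 (1 : triv)) n
    (fun s t h => by rw [hn s t h]) (fun s G χ x => by
      rw [← RC_gright_apply, mul_comm, ← RC_gleft_apply]
      exact congrArg (fun f => (locFun f s).1 x) (key G χ))
  have h1 : locFun m 1 = RC.one := hg triv RC.one
  beta_reduce at h0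
  rw [h1] at h0
  exact one_ne_zero (triv_character.symm.trans h0)

/-- λ is surjective, each χ being the value at 1 of a constant map, so projectivity would lift the
identity of `RC` to a section of λ. -/
theorem regular_RC_not_projective : ¬ RC.regular.IsProjective := by
  intro h
  obtain ⟨g, hg⟩ := h Loc RC.regular lam
    ⟨fun G => AddMonoidHom.id _, fun _ _ => rfl, fun _ _ => rfl, fun _ _ => rfl⟩
    (fun G χ => ⟨constant G χ, rfl⟩)
  exact lam_not_split g hg

/-! ### Factoring the product morphism μ through λ -/

/-- The composition of two morphisms of bimodules. -/
def Bimodule.Hom.comp {A : GreenFunctor.{u}} {M : Bimodule.{u, v} A} {N : Bimodule.{u, w} A}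
    {P : Bimodule.{u, x} A} (q : N.Hom P) (p : M.Hom N) : M.Hom P where
  app G := (q.app G).comp (p.app G)
  naturality φ m := by simp [p.naturality, q.naturality]
  map_lact a m := by simp [p.map_lact, q.map_lact]
  map_ract m a := by simp [p.map_ract, q.map_ract]

/-- The map `R_ℂ ⊗ R_ℂ → Loc` at `K`, sending `[a ⊗ b]` to `s ↦ s(a) × b`. -/
def tensToLocApp (K : FiniteGrp.{0}) :
    Tens RC.toBisetFunctor RC.toBisetFunctor K →+ Loc.obj K :=
  Tens.lift (fun D _ a b f => Loc.map f (Loc.ract (orbit D a) b))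
    (fun _ _ _ _ _ _ => by simp) (fun _ _ _ _ _ _ => by simp) (fun _ _ _ _ _ _ => by simp)
    -- The balancing relation holds because the Galois action commutes with the biset operations.
    (fun _ _ _ _ α β a b f => by rw [Loc.map_comp, Loc.ract_map, orbit_map])

theorem tensToLocApp_mk {K D D' : FiniteGrp.{0}} (a : RC.obj D) (b : RC.obj D')
    (f : Burn K (gprod D D')) :
    tensToLocApp K (Tens.mk (M := RC.toBisetFunctor) (N := RC.toBisetFunctor) a b f) =
      Loc.map f (Loc.ract (orbit D a) b) := by
  simp only [tensToLocApp, Tens.lift_mk]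

/-- The morphism of bimodules `R_ℂ ⊗ R_ℂ → Loc` sending `[a ⊗ b]` to `s ↦ s(a) × b`. -/
def tensToLoc : RC.tensSelf.Hom Loc where
  app := tensToLocApp
  naturality {H G} φ y := by
    change tensToLocApp H (Tens.map φ y) = Loc.map φ (tensToLocApp G y)
    induction y using Tens.ind with
    | h0 => simp
    | hn y hy => simp [hy]
    | ha y z hy hz => simp [hy, hz]
    | ho D D' b c f => rw [Tens.map_mk, tensToLocApp_mk, tensToLocApp_mk, Loc.map_comp]
  map_lact {G H} a y := by
    change tensToLocApp _ (Tens.lact a y) = Loc.lact a (tensToLocApp H y)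
    induction y using Tens.ind with
    | h0 => simp
    | hn y hy => simp [hy]
    | ha y z hy hz => simp [hy, hz]
    | ho D D' b c f =>
      -- Left linearity rests on s(a × b) = s(a) × s(b), through `orbit_mul`.
      rw [Tens.lact_mk, tensToLocApp_mk, tensToLocApp_mk, Loc.map_comp, orbit_mul, Loc.lact_ract,
        Loc.lact_map, RC.map_id]
  map_ract {G H} y a := by
    change tensToLocApp _ (Tens.ract y a) = Loc.ract (tensToLocApp G y) a
    induction y using Tens.ind with
    | h0 => simp
    | hn y hy => simp [hy]
    | ha y z hy hz => simp [hy, hz]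
    | ho D D' b c f =>
      rw [Tens.ract_mk, tensToLocApp_mk, tensToLocApp_mk, ← Loc.ract_mul, ← Loc.map_comp,
        Burn.comp_assoc, Burn.iso_comp_iso, MulEquiv.self_trans_symm, Loc.map_comp]
      -- The associativity isomorphism and its inverse have composed to the identity isomorphism,
      -- whose class is `Burn.id` by definition.
      change Loc.map _ (Loc.map (Burn.id _) _) = _
      rw [Loc.map_id, Loc.ract_map, RC.map_id]

/-- At s = 1 the twist disappears and s(a) × b becomes a × b. It suffices to compare the two
morphisms on generating symbols. -/
theorem lam_tensToLoc {K : FiniteGrp.{0}} (y : RC.tensSelf.obj K) :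
    lam.app K (tensToLoc.app K y) = RC.mu.app K y := by
  refine DFunLike.congr_fun (f := (lam.app K).comp (tensToLocApp K)) (g := Tens.mu)
    (Tens.hom_ext fun D D' a b f => ?_) y
  rw [AddMonoidHom.comp_apply, tensToLocApp_mk, lam.naturality, lam.map_ract, lam_orbit]
  exact (Tens.mu_mk a b f).symm

/-- A section of μ, followed by `tensToLoc`, would be a section of λ. This does not go through
`IsProjective`, whose test bimodules lie in the universe of `RC.regular`, whereas `RC.tensSelf` lies
one universe higher. -/
theorem RC_not_separable : ¬ RC.IsSeparable := by
  rintro ⟨σ, hσ⟩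
  exact lam_not_split (tensToLoc.comp σ) fun G χ =>
    (lam_tensToLoc (σ.app G χ)).trans (hσ G χ)

/-! ### The kernel of a morphism of bimodules and the derivation `χ ↦ (s ↦ s(χ) - χ)` -/

theorem Bimodule.Hom.isSubbimodule_ker {A : GreenFunctor.{u}} {M : Bimodule.{u, v} A}
    {N : Bimodule.{u, w} A} (p : M.Hom N) : M.IsSubbimodule (fun G => (p.app G).ker) where
  map_mem φ m hm := by
    rw [AddMonoidHom.mem_ker] at hm ⊢
    rw [p.naturality, hm, map_zero]
  lact_mem a m hm := by
    rw [AddMonoidHom.mem_ker] at hm ⊢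
    rw [p.map_lact, hm, map_zero]
  ract_mem m a hm := by
    rw [AddMonoidHom.mem_ker] at hm ⊢
    rw [p.map_ract, hm, map_zero, AddMonoidHom.zero_apply]

/-- The kernel `L` of `λ : Loc → R_ℂ`. -/
abbrev lamKer : Bimodule.{0, 0} RC := Loc.sub (fun G => (lam.app G).ker) lam.isSubbimodule_ker

/-- The maps `d_G : R_ℂ(G) → L(G)` sending `χ` to `s ↦ s(χ) - χ`. -/
def galoisDer (G : FiniteGrp.{0}) : RC.obj G →+ lamKer.obj G :=
  (orbit G - constant G).codRestrict (lam.app G).ker fun χ => by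
    -- The orbit and the constant map of χ have the same value χ at s = 1, so their difference is in
    -- the kernel.
    rw [AddMonoidHom.mem_ker, AddMonoidHom.sub_apply, map_sub, lam_orbit, lam_constant]
    exact sub_self χ

/-- With d = orbit - constant, left linearity of the first and right linearity of the second leave,
besides d(χ × ρ), only the terms -(χ × constant ρ) and (orbit χ) × ρ, which cancel by
`lact_constant`. -/
theorem galoisDer_mem : galoisDer ∈ Der lamKer := by
  refine ⟨fun H G φ χ => Subtype.ext ?_, fun G H χ ρ => Subtype.ext ?_⟩
  · change orbit H _ - constant H _ = Loc.map φ (orbit G χ - constant G χ)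
    rw [orbit_map, constant_map, map_sub]
  · change orbit _ _ - constant _ _ = Loc.lact χ (orbit H ρ - constant H ρ) +
      Loc.ract (orbit G χ - constant G χ) ρ
    rw [orbit_mul, constant_mul, map_sub, map_sub, AddMonoidHom.sub_apply, lact_constant]
    abel

/-- An equality of d with the inner derivation of m reads s(χ) m(s) - m(s) χ = s(χ) - χ, that is, 1
- m(s) intertwines the twisted and untwisted actions. The criterion gives m(1) = 1, whereas m in the
kernel of λ means m(1) = 0. Membership in L is essential here: in `Loc` the constant map 1 would be
a valid m. -/
theorem galoisDer_not_inner : galoisDer ∉ (innerDer lamKer).range := by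
  rintro ⟨m, hm⟩
  let m' : Loc.obj triv := Subtype.val (p := (· ∈ (lam.app triv).ker)) m
  obtain ⟨n, hn⟩ := exists_conductor m'
  have h1 : locFun m' 1 = 0 := m.2
  have h0 := eq_zero_of_intertwines (fun s => 1 - (locFun m' s).1 (1 : triv)) n
    (fun s t h => by rw [hn s t h]) (fun s G χ x => by
      -- The equality of derivations with values in L is read in `Loc`, then evaluated at s and x in
      -- `key'`.
      have key : Loc.map (Burn.iso (gright G)) (Loc.lact χ m') -
          Loc.map (Burn.iso (gleft G)) (Loc.ract m' χ) = orbit G χ - constant G χ :=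
        congrArg (fun d => Subtype.val (p := (· ∈ (lam.app G).ker)) (d G χ)) hm
      have key' : (RC.map (Burn.iso (gright G)) (RC.mul (galois s χ) (locFun m' s))).1 x -
          (RC.map (Burn.iso (gleft G)) (RC.mul (locFun m' s) χ)).1 x =
          (galois s χ).1 x - χ.1 x := congrArg (fun f => (locFun f s).1 x) key
      rw [RC_gright_apply, RC_gleft_apply] at key'
      linear_combination -key')
  beta_reduce at h0
  rw [h1] at h0
  have h2 : ((0 : RC.obj triv).1 (1 : triv) : ℂ) = 0 := rfl
  rw [h2, sub_zero] at h0
  exact one_ne_zero h0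

/-! ### Shifting by the trivial group -/

/-- Obtained from `Burn.right_nat` by composing with the inverse isomorphisms on both sides. It
provides the naturality of `Bimodule.toShiftTriv`. -/
theorem Burn.right_symm_nat {H G : FiniteGrp.{0}} (y : Burn H G) :
    Burn.comp (Burn.iso (gright H).symm) y =
      Burn.comp (Burn.prod y (Burn.id triv)) (Burn.iso (gright G).symm) := by
  have h := congrArg (fun t => Burn.comp (Burn.iso (gright H).symm)
    (Burn.comp t (Burn.iso (gright G).symm))) (Burn.right_nat y)
  simp only [Burn.comp_assoc, Burn.iso_comp_iso, MulEquiv.symm_trans_self] at h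
  rw [← Burn.comp_assoc, Burn.iso_comp_iso, MulEquiv.self_trans_symm] at h
  change Burn.comp (Burn.id _) _ = Burn.comp _ (Burn.comp _ (Burn.id _)) at h
  rw [Burn.id_comp, Burn.comp_id] at h
  exact h.symm

section ShiftTriv

variable {A : GreenFunctor.{u}} (M : Bimodule.{u, v} A)

/-- The morphism of bimodules `M → M(- × 1)`. -/
def Bimodule.toShiftTriv : M.Hom (M.shift triv) where
  app G := M.map (Burn.iso (gright G).symm)
  naturality {H G} φ m := by
    refine ((M.map_comp _ _ m).symm.trans ?_).trans (M.map_comp _ _ m)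
    exact congrArg (fun ψ => M.map ψ m) (Burn.right_symm_nat φ)
  map_lact {G H} a m := by
    refine Eq.trans ?_ (congrArg (M.map (Burn.iso (gassoc G H triv).symm))
      (M.lact_iso a (gright H).symm m)).symm
    rw [M.iso_iso]
    -- Both sides are now the transport of the same product along one isomorphism from G × H to (G ×
    -- H) × 1, the two composites being equal by definition.
    rfl
  map_ract {G H} m a := by
    refine Eq.trans ?_ (congrArg (M.map (Burn.iso (gswap G triv H)))
      (M.ract_iso a (gright G).symm m)).symm
    rw [M.iso_iso]
    rfl

/-- The morphism of bimodules `M(- × 1) → M`. -/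
def Bimodule.ofShiftTriv : (M.shift triv).Hom M where
  app G := M.map (Burn.iso (gright G))
  naturality {H G} φ (m : M.obj (gprod G triv)) := by
    refine ((M.map_comp _ _ m).symm.trans ?_).trans (M.map_comp _ _ m)
    exact congrArg (fun ψ => M.map ψ m) (Burn.right_nat φ)
  map_lact {G H} a (m : M.obj (gprod H triv)) := by
    exact (M.iso_iso _ _ _).trans (M.lact_iso a (gright H) m).symm
  map_ract {G H} (m : M.obj (gprod G triv)) a := by
    exact (M.iso_iso _ _ _).trans (M.ract_iso a (gright G) m).symm

theorem Bimodule.ofShiftTriv_toShiftTriv {G : FiniteGrp.{0}} (m : M.obj G) :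
    M.ofShiftTriv.app G (M.toShiftTriv.app G m) = m := by
  refine (M.iso_iso (gright G).symm (gright G) m).trans ?_
  rw [MulEquiv.symm_trans_self]
  exact M.map_id _ m

/-- The value of `HH1 M` at the trivial group is built from derivations into M(- × 1) rather than
into M. The derivation is pushed into M(- × 1); if it became inner there, pushing it back would make
it inner in M, because morphisms of bimodules preserve inner derivations. Only the composite M → M(-
× 1) → M needs to be the identity. -/
theorem HH1_triv_nontrivial {d : ∀ G : FiniteGrp.{0}, A.obj G →+ M.obj G} (hd : d ∈ Der M)
    (hinn : d ∉ (innerDer M).range) : Nontrivial ((HH1 M).obj triv) := by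
  refine ⟨⟨QuotientAddGroup.mk (s := Inn (M.shift triv)) (Der.push M.toShiftTriv ⟨d, hd⟩), 0,
    fun h => hinn ?_⟩⟩
  have h1 : Der.push M.toShiftTriv ⟨d, hd⟩ ∈ Inn (M.shift triv) :=
    (QuotientAddGroup.eq_zero_iff _).1 h
  have h2 : Der.push M.ofShiftTriv (Der.push M.toShiftTriv ⟨d, hd⟩) ∈ Inn M :=
    Inn.push_mem M.ofShiftTriv h1
  have h3 : Der.push M.ofShiftTriv (Der.push M.toShiftTriv ⟨d, hd⟩) = ⟨d, hd⟩ := by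
    apply Subtype.ext
    funext G
    ext a
    exact M.ofShiftTriv_toShiftTriv (d G a)
  rw [h3] at h2
  exact h2

end ShiftTriv

end BisetHH

end

/-- The existential over `hL` is the first assertion; its witness is also what turns the family of
kernels into a bimodule, on which the other clauses depend. -/
theorem proposition3 :
    ∃ hL : Loc.IsSubbimodule (fun G => (lam.app G).ker),
      (∃ d ∈ Der (Loc.sub (fun G => (lam.app G).ker) hL),
        (∀ (G : FiniteGrp.{0}) (χ : RC.obj G) (s : ZHatUnits),
          locFun ((Loc.incl (fun G => (lam.app G).ker) hL).app G (d G χ)) s = galois s χ - χ) ∧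
        d ∉ (innerDer (Loc.sub (fun G => (lam.app G).ker) hL)).range) ∧
      Nontrivial ((HH1 (Loc.sub (fun G => (lam.app G).ker) hL)).obj triv) ∧
      (∃ X : FiniteGrp.{0}, Nontrivial ((HH1 (Loc.sub (fun G => (lam.app G).ker) hL)).obj X)) ∧
      ¬ RC.IsSeparable ∧ ¬ RC.regular.IsProjective := by
  exact ⟨lam.isSubbimodule_ker, ⟨galoisDer, galoisDer_mem, fun _ _ _ => rfl, galoisDer_not_inner⟩,
    HH1_triv_nontrivial _ galoisDer_mem galoisDer_not_inner,
    -- The trivial group already witnesses that the cohomology functor is non-zero.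
    ⟨triv, HH1_triv_nontrivial _ galoisDer_mem galoisDer_not_inner⟩,
    RC_not_separable, regular_RC_not_projective⟩
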